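/- There is an algorithm that solves Unweighted Min Stable Cut exactly in time $\Delta^{O(\mathrm{tw})}(n+N)^{O(1)}$, where the input is a finite simple graph $G$ with $n$ vertices and maximum degree $\Delta$ (with $\Delta$ replaced by $1$ in this bound if $G$ has no edges), together with a tree decomposition of $G$ of width $\mathrm{tw}$ with $N$ nodes; so the time is $\Delta^{O(\mathrm{tw})}n^{O(1)}$ for decompositions with $N\le n^{O(1)}$ nodes. Here a cut of $G=(V,E)$ is a partition of $V$ into two (possibly empty) sets $V_0,V_1$; it is stable if every vertex $v$ has at least $\deg(v)/2$ of its neighbors on the side that does not contain $v$; and to solve Unweighted Min Stable Cut on $G$ is to return a stable cut with the minimum number of edges between $V_0$ and $V_1$. The width of a tree decomposition is the maximum size of its bags minus one (and $0$ if all bags are empty). Precisely: there are one program $P$ and one constant $c$ such that for every such $G$ with vertex set $\{0,\dots,n-1\}$ and every such tree decomposition, the program $P$, given the adjacency matrices of $G$ and of the tree of the decomposition and the characteristic vectors of the bags, halts with a minimum stable cut of $G$ as its output, after at most $c\cdot\max(\Delta,1)^{c\cdot\mathrm{tw}}\cdot(n+N)^{c}$ steps. Programs are while programs over binary trees (finitely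 many variables, each holding a pointer to a binary tree; assignment, sequence, branching, while loop), where creating a cell, accessing a component of a cell, testing for a leaf, and assigning a variable take one step each; up to a polynomial, the number of steps is the running time on Turing machines or random access machines. -/

import Mathlib

/-! ### Weighted graphs, cuts and the problem Min Stable Cut -/

namespace MinStableCut

section Cuts

variable {V : Type*} [Fintype V] [DecidableEq V]
  (G : SimpleGraph V) [DecidableRel G.Adj] (w : Sym2 V → ℕ)

/-- The weighted degree `d_w(v)`: the total weight of the edges incident on `v`. -/
def weightedDegree (v : V) : ℕ :=
  ∑ u ∈ G.neighborFinset v, w s(v, u)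

/-- The total weight of the edges incident on `v` that are cut. A cut, that is a partition of the
vertices into `V₀` and `V₁`, is given by the map `side` that sends the vertices of `V₀` to `false`
and those of `V₁` to `true`. -/
def crossingWeight (side : V → Bool) (v : V) : ℕ :=
  ∑ u ∈ G.neighborFinset v with side u ≠ side v, w s(v, u)

/-- A cut is stable for `v` if the cut edges at `v` weigh at least half the weighted degree. -/
def IsStableAt (side : V → Bool) (v : V) : Prop :=
  (weightedDegree G w v : ℚ) / 2 ≤ (crossingWeight G w side v : ℚ)

/-- A cut is stable if it is stable for all vertices. -/
def IsStable (side : V → Bool) : Prop :=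
  ∀ v, IsStableAt G w side v

/-- The weight of a cut: the sum of the weights of the edges with endpoints on both sides. -/
def cutWeight (side : V → Bool) : ℕ :=
  ∑ e ∈ G.edgeFinset with (∃ u ∈ e, ∃ v ∈ e, side u ≠ side v), w e

/-- The optimal solutions of Min Stable Cut: the stable cuts of minimum weight. -/
def IsOptimal (side : V → Bool) : Prop :=
  IsStable G w side ∧ ∀ side' : V → Bool, IsStable G w side' → cutWeight G w side ≤ cutWeight G w side'

/-- The optimal solutions of Unweighted Min Stable Cut, where all edges have weight one. -/
def IsUnweightedOptimal (side : V → Bool) : Prop :=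
  IsOptimal G (fun _ => 1) side

end Cuts

/-! ### Tree decompositions -/

/-- A tree decomposition of `G` whose tree has node set `ι`. -/
structure TreeDecomposition {V : Type*} (G : SimpleGraph V) (ι : Type*) where
  /-- the tree on the nodes of the decomposition -/
  tree : SimpleGraph ι
  isTree : tree.IsTree
  /-- the bag of each node -/
  bag : ι → Finset V
  exists_mem_bag : ∀ v, ∃ t, v ∈ bag t
  exists_edge_bag : ∀ u v, G.Adj u v → ∃ t, u ∈ bag t ∧ v ∈ bag t
  connected : ∀ v, (tree.induce {t | v ∈ bag t}).Connected

/-- The width of a tree decomposition: the largest size of a bag, minus one. -/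
def TreeDecomposition.width {V : Type*} {G : SimpleGraph V} {ι : Type*} [Fintype ι]
    (D : TreeDecomposition G ι) : ℕ :=
  (Finset.univ.sup fun t => (D.bag t).card) - 1

/-! ### The machine model

While programs over binary trees (the language WHILE of N. Jones, "Computability and Complexity
from a Programming Perspective"). A program has finitely many variables, each of which holds (a
pointer to) a binary tree, and it is charged one step for every single operation on pointers: the
creation of a cell, the access to one of the two components of a cell, the test whether a tree is
a leaf, an assignment. There is no arithmetic and no comparison of trees in unit time. Up to a
polynomial, the running time in this model is that of Turing machines or random access machines
of logarithmic cost. -/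

/-- The data of the programs. -/
inductive Data : Type
  | nil : Data
  | cons (l r : Data) : Data

/-- The left component; that of `nil` is `nil`. -/
def Data.hd : Data → Data
  | nil => nil
  | cons l _ => l

/-- The right component; that of `nil` is `nil`. -/
def Data.tl : Data → Data
  | nil => nil
  | cons _ r => r

/-- A store assigns a tree to every variable; variables are numbered. -/
abbrev Store : Type := ℕ → Data

/-- The expressions of the programming language. -/
inductive Term : Type
  | var (i : ℕ) : Term
  | nil : Term
  | cons (a b : Term) : Term
  | hd (a : Term) : Term
  | tl (a : Term) : Term

/-- The value of an expression. -/
def Term.eval (σ : Store) : Term → Data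
  | var i => σ i
  | nil => Data.nil
  | cons a b => Data.cons (a.eval σ) (b.eval σ)
  | hd a => (a.eval σ).hd
  | tl a => (a.eval σ).tl

/-- The number of steps that the evaluation of an expression takes. -/
def Term.cost : Term → ℕ
  | var _ => 1
  | nil => 1
  | cons a b => a.cost + b.cost + 1
  | hd a => a.cost + 1
  | tl a => a.cost + 1

/-- The programs: assignment, sequence, branching and loop. A condition holds if its value is
not `nil`. -/
inductive Program : Type
  | assign (i : ℕ) (a : Term) : Program
  | seq (p q : Program) : Program
  | ite (a : Term) (p q : Program) : Program
  | loop (a : Term) (p : Program) : Program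

/-- `p.Runs σ σ' t`: the program `p`, started in the store `σ`, halts after `t` steps in the
store `σ'`. -/
inductive Program.Runs : Program → Store → Store → ℕ → Prop
  | assign (i : ℕ) (a : Term) (σ : Store) :
      Runs (assign i a) σ (Function.update σ i (a.eval σ)) (a.cost + 1)
  | seq {p q : Program} {σ σ' σ'' : Store} {t t' : ℕ} :
      Runs p σ σ' t → Runs q σ' σ'' t' → Runs (seq p q) σ σ'' (t + t')
  | ite_true {a : Term} {p q : Program} {σ σ' : Store} {t : ℕ} :
      a.eval σ ≠ Data.nil → Runs p σ σ' t → Runs (ite a p q) σ σ' (a.cost + 1 + t)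
  | ite_false {a : Term} {p q : Program} {σ σ' : Store} {t : ℕ} :
      a.eval σ = Data.nil → Runs q σ σ' t → Runs (ite a p q) σ σ' (a.cost + 1 + t)
  | loop_true {a : Term} {p : Program} {σ σ' σ'' : Store} {t t' : ℕ} :
      a.eval σ ≠ Data.nil → Runs p σ σ' t → Runs (loop a p) σ' σ'' t' →
        Runs (loop a p) σ σ'' (a.cost + 1 + t + t')
  | loop_false {a : Term} {p : Program} {σ : Store} :
      a.eval σ = Data.nil → Runs (loop a p) σ σ (a.cost + 1)

/-- The initial store: the input is in variable `0`, all other variables hold `nil`. -/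
def initStore (x : Data) : Store :=
  Function.update (fun _ => Data.nil) 0 x

/-- On the input `x` the program halts after exactly `t` steps, with the output `y` in
variable `0`. -/
def Program.Outputs (p : Program) (x y : Data) (t : ℕ) : Prop :=
  ∃ σ : Store, p.Runs (initStore x) σ t ∧ σ 0 = y

/-! ### Encoding of instances and solutions -/

/-- Truth values: `false` is a leaf, `true` is a cell with two leaves. -/
def Data.ofBool : Bool → Data
  | false => nil
  | true => cons nil nil

/-- Lists, as chains of cells that end in a leaf. -/
def Data.ofList : List Data → Data
  | [] => nil
  | x :: l => cons x (ofList l)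

/-- The list of the values of a truth-valued function on `{0, …, n - 1}`. -/
def Data.ofVector {n : ℕ} (f : Fin n → Bool) : Data :=
  ofList (List.ofFn fun i => ofBool (f i))

/-- A matrix of truth values, as the list of its rows. -/
def Data.ofMatrix {m n : ℕ} (f : Fin m → Fin n → Bool) : Data :=
  ofList (List.ofFn fun i => ofVector (f i))

/-- An instance: the adjacency matrix of the graph, the adjacency matrix of the tree of the
decomposition, and the list of the bags, each as the characteristic vector of a set of
vertices. -/
def encodeInstance {n N : ℕ} (G : SimpleGraph (Fin n)) [DecidableRel G.Adj]
    (D : TreeDecomposition G (Fin N)) [DecidableRel D.tree.Adj] : Data :=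
  Data.cons (Data.ofMatrix fun u v => decide (G.Adj u v))
    (Data.cons (Data.ofMatrix fun s t => decide (D.tree.Adj s t))
      (Data.ofMatrix fun t v => decide (v ∈ D.bag t)))

end MinStableCut

/-!
Two cuts are interchangeable on a set `A` of vertices if they are both stable or both unstable for
the vertices of `A` without neighbors outside of `A`, have the same weight inside `A`, and agree on
the boundary of `A` as well as in the numbers of cut edges from each boundary vertex into `A`. One
may then replace the other on `A` in every cut. A boundary of at most `tw + 1` vertices leaves
`Δ ^ O(tw + 1) * (n * Δ + 1)` classes, and a table of representatives for `A ∪ B` is obtained from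
tables for `A` and `B` by combining all pairs and keeping one cut of each class.

Such tables are built for the bags, vertex by vertex, and then merged along the edges of the tree:
a leaf of the remaining tree is contracted into its neighbor, and the boundary of the union of the
bags of the contracted nodes always lies in a single bag. In the end there is a table for the set
of all vertices. If `Δ ≤ 1`, then the stable cuts are those that cut every edge.

For the running time, a function between encoded types is shown to be computable in polynomial time
by composition. The sizes of the tables enter through a budget that counts as a part of the size of
the instance; the budget is `Δ ^ O(tw) * (n + N) ^ O(1)`.
-/

namespace MinStableCut

/-! ### Polynomial-time functions -/

/-- The types on which programs compute: their elements are encoded as binary trees and have a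
size. The size need not be that of the tree, since a type may carry a budget for the computations
on its elements. -/
class Encoded (α : Type) where
  encode : α → Data
  size : α → ℕ

open Encoded

/-- Bounds that are polynomial in the size of the argument. -/
def PolyBdd {α : Type} [Encoded α] (u : α → ℕ) : Prop :=
  ∃ c, ∀ a, u a ≤ (size a + 2) ^ c

section PolyBdd

variable {α β : Type} [Encoded α] [Encoded β] {u v : α → ℕ}

theorem PolyBdd.mono (hv : PolyBdd v) (huv : ∀ a, u a ≤ v a) : PolyBdd u :=
  let ⟨c, hc⟩ := hv
  ⟨c, fun a => (huv a).trans (hc a)⟩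

protected theorem PolyBdd.size : PolyBdd (fun a : α => size a) :=
  ⟨1, fun a => by rw [pow_one]; exact Nat.le_add_right _ 2⟩

theorem PolyBdd.const (k : ℕ) : PolyBdd (fun _ : α => k) :=
  ⟨k, fun _ => Nat.lt_two_pow_self.le.trans (Nat.pow_le_pow_left (Nat.le_add_left _ _) k)⟩

theorem PolyBdd.mul (hu : PolyBdd u) (hv : PolyBdd v) : PolyBdd (fun a => u a * v a) := by
  obtain ⟨c, hc⟩ := hu
  obtain ⟨d, hd⟩ := hv
  exact ⟨c + d, fun a => (Nat.mul_le_mul (hc a) (hd a)).trans_eq (pow_add _ c d).symm⟩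

theorem PolyBdd.add (hu : PolyBdd u) (hv : PolyBdd v) : PolyBdd (fun a => u a + v a) := by
  obtain ⟨c, hc⟩ := hu
  obtain ⟨d, hd⟩ := hv
  refine ⟨c + d + 1, fun a => ?_⟩
  have hu' : u a ≤ (size a + 2) ^ (c + d) :=
    (hc a).trans (Nat.pow_le_pow_right (by omega) (by omega))
  have hv' : v a ≤ (size a + 2) ^ (c + d) :=
    (hd a).trans (Nat.pow_le_pow_right (by omega) (by omega))
  calc u a + v a ≤ (size a + 2) ^ (c + d) * 2 := by omega
    _ ≤ (size a + 2) ^ (c + d + 1) := Nat.mul_le_mul_left _ (by omega)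

theorem PolyBdd.pow (hu : PolyBdd u) (k : ℕ) : PolyBdd (fun a => u a ^ k) := by
  obtain ⟨c, hc⟩ := hu
  exact ⟨c * k, fun a => (Nat.pow_le_pow_left (hc a) k).trans_eq (pow_mul _ c k).symm⟩

theorem PolyBdd.comp {w : β → ℕ} {f : α → β} (hw : PolyBdd w)
    (hf : PolyBdd fun a => size (f a)) : PolyBdd (fun a => w (f a)) :=
  let ⟨c, hc⟩ := hw
  ((hf.add (.const 2)).pow c).mono fun a => hc (f a)

end PolyBdd

/-! ### Programs with an accumulator and a stack -/

/-- The store with `x` in variable `0`, the accumulator, and with `s` in variable `1`, the stack. -/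
def store (x s : Data) : Store
  | 0 => x
  | 1 => s
  | _ => .nil

/-- `p.RunsWithin σ σ' T`: started in the store `σ`, the program `p` halts in the store `σ'` after
at most `T` steps. -/
def Program.RunsWithin (p : Program) (σ σ' : Store) (T : ℕ) : Prop :=
  ∃ t ≤ T, p.Runs σ σ' t

namespace Program

variable {p q : Program} {σ σ' σ'' : Store} {T T' : ℕ}

theorem RunsWithin.mono (h : p.RunsWithin σ σ' T) (hT : T ≤ T') : p.RunsWithin σ σ' T' :=
  let ⟨t, ht, hp⟩ := h
  ⟨t, ht.trans hT, hp⟩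

theorem RunsWithin.seq (hp : p.RunsWithin σ σ' T) (hq : q.RunsWithin σ' σ'' T') :
    (Program.seq p q).RunsWithin σ σ'' (T + T') :=
  let ⟨_, ht, hp⟩ := hp
  let ⟨_, ht', hq⟩ := hq
  ⟨_, add_le_add ht ht', .seq hp hq⟩

theorem RunsWithin.ite_true {e : Term} (he : e.eval σ ≠ .nil) (hp : p.RunsWithin σ σ' T) :
    (Program.ite e p q).RunsWithin σ σ' (e.cost + 1 + T) :=
  let ⟨_, ht, hp⟩ := hp
  ⟨_, Nat.add_le_add_left ht _, .ite_true he hp⟩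

theorem RunsWithin.ite_false {e : Term} (he : e.eval σ = .nil) (hq : q.RunsWithin σ σ' T) :
    (Program.ite e p q).RunsWithin σ σ' (e.cost + 1 + T) :=
  let ⟨_, ht, hq⟩ := hq
  ⟨_, Nat.add_le_add_left ht _, .ite_false he hq⟩

theorem RunsWithin.loop_true {e : Term} (he : e.eval σ ≠ .nil) (hp : p.RunsWithin σ σ' T)
    (hloop : (Program.loop e p).RunsWithin σ' σ'' T') :
    (Program.loop e p).RunsWithin σ σ'' (e.cost + 1 + T + T') :=
  let ⟨_, ht, hp⟩ := hp
  let ⟨_, ht', hloop⟩ := hloop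
  ⟨_, by omega, .loop_true he hp hloop⟩

theorem RunsWithin.loop_false {e : Term} (he : e.eval σ = .nil) :
    (Program.loop e p).RunsWithin σ σ (e.cost + 1) :=
  ⟨_, le_rfl, .loop_false he⟩

theorem runsWithin_assign_zero (e : Term) (x s : Data) :
    (assign 0 e).RunsWithin (store x s) (store (e.eval (store x s)) s) (e.cost + 1) := by
  refine ⟨_, le_rfl, ?_⟩
  convert Runs.assign 0 e (store x s) using 1
  funext i
  rcases i with _ | _ | i <;> rfl

theorem runsWithin_assign_one (e : Term) (x s : Data) :
    (assign 1 e).RunsWithin (store x s) (store x (e.eval (store x s))) (e.cost + 1) := by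
  refine ⟨_, le_rfl, ?_⟩
  convert Runs.assign 1 e (store x s) using 1
  funext i
  rcases i with _ | _ | i <;> rfl

/-- Pushes the accumulator on the stack. -/
def push : Program := assign 1 (.cons (.var 0) (.var 1))

/-- Replaces the accumulator by the top of the stack, which is removed. -/
def pop : Program := seq (assign 0 (.hd (.var 1))) (assign 1 (.tl (.var 1)))

/-- Swaps the accumulator and the top of the stack. -/
def swap : Program :=
  seq (assign 1 (.cons (.var 0) (.var 1)))
    (seq (assign 0 (.hd (.tl (.var 1)))) (assign 1 (.cons (.hd (.var 1)) (.tl (.tl (.var 1))))))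

/-- Replaces the accumulator by the pair of the top of the stack, which is removed, and itself. -/
def pair : Program :=
  seq (assign 0 (.cons (.hd (.var 1)) (.var 0))) (assign 1 (.tl (.var 1)))

theorem runsWithin_push (x s : Data) : push.RunsWithin (store x s) (store x (.cons x s)) 4 :=
  runsWithin_assign_one ..

theorem runsWithin_pop (x y s : Data) : pop.RunsWithin (store x (.cons y s)) (store y s) 6 :=
  (runsWithin_assign_zero ..).seq (runsWithin_assign_one ..)

theorem runsWithin_swap (x y s : Data) :
    swap.RunsWithin (store x (.cons y s)) (store y (.cons x s)) 15 :=
  (runsWithin_assign_one ..).seq ((runsWithin_assign_zero ..).seq (runsWithin_assign_one ..))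

theorem runsWithin_pair (x y s : Data) :
    pair.RunsWithin (store x (.cons y s)) (store (.cons y x) s) 8 :=
  (runsWithin_assign_zero ..).seq (runsWithin_assign_one ..)

end Program

/-- The program `p` computes `f` in time `T`, with argument and value in the accumulator, and
leaves the stack as it was. -/
def Program.Computes {α β : Type} [Encoded α] [Encoded β] (p : Program) (f : α → β)
    (T : α → ℕ) : Prop :=
  ∀ a s, p.RunsWithin (store (encode a) s) (store (encode (f a)) s) (T a)

/-- Functions that are computed in polynomial time and have values of polynomial size. -/
@[fun_prop]
def PolyTime {α β : Type} [Encoded α] [Encoded β] (f : α → β) : Prop :=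
  PolyBdd (fun a => size (f a)) ∧ ∃ p T, PolyBdd T ∧ Program.Computes p f T

section PolyTime

variable {α β γ δ : Type} [Encoded α] [Encoded β] [Encoded γ] [Encoded δ]

theorem PolyTime.polyBdd_size {f : α → β} (hf : PolyTime f) : PolyBdd fun a => size (f a) := hf.1

@[fun_prop]
protected theorem PolyTime.id : PolyTime (fun a : α => a) :=
  ⟨.size, .assign 0 (.var 0), _, .const 2, fun _ _ => Program.runsWithin_assign_zero ..⟩

@[fun_prop]
protected theorem PolyTime.comp {g : β → γ} {f : α → β} (hg : PolyTime g) (hf : PolyTime f) :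
    PolyTime (fun a => g (f a)) := by
  obtain ⟨f_size, p, T, hT, hp⟩ := hf
  obtain ⟨g_size, q, T', hT', hq⟩ := hg
  exact ⟨g_size.comp f_size, .seq p q, _, hT.add (hT'.comp f_size),
    fun a s => (hp a s).seq (hq (f a) s)⟩

theorem PolyTime.of_eval {f : α → β} {g : α → γ} (hf : PolyTime f) (e : Term)
    (he : ∀ a s, e.eval (store (encode (f a)) s) = encode (g a))
    (g_size : PolyBdd fun a => size (g a)) : PolyTime g := by
  obtain ⟨-, p, T, hT, hp⟩ := hf
  exact ⟨g_size, .seq p (.assign 0 e), _, hT.add (.const (e.cost + 1)),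
    fun a s => (hp a s).seq (he a s ▸ Program.runsWithin_assign_zero ..)⟩

theorem exists_term_eval_eq (d : Data) : ∃ e : Term, ∀ σ, e.eval σ = d := by
  induction d with
  | nil => exact ⟨.nil, fun _ => rfl⟩
  | cons l r ihl ihr =>
    obtain ⟨el, hl⟩ := ihl
    obtain ⟨er, hr⟩ := ihr
    exact ⟨.cons el er, fun σ => congr_arg₂ _ (hl σ) (hr σ)⟩

@[fun_prop]
protected theorem PolyTime.const (b : β) : PolyTime (fun _ : α => b) :=
  let ⟨e, he⟩ := exists_term_eval_eq (encode b)
  PolyTime.id.of_eval e (fun _ _ => he _) (.const _)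

instance : Encoded (α × β) where
  encode x := .cons (encode x.1) (encode x.2)
  size x := size x.1 + size x.2 + 1

theorem size_prod (x : α × β) : size x = size x.1 + size x.2 + 1 := rfl

@[fun_prop]
protected theorem PolyTime.prodMk {f : α → β} {g : α → γ} (hf : PolyTime f) (hg : PolyTime g) :
    PolyTime (fun a => (f a, g a)) := by
  obtain ⟨f_size, p, T, hT, hp⟩ := hf
  obtain ⟨g_size, q, T', hT', hq⟩ := hg
  exact ⟨(f_size.add g_size).add (.const 1),
    .seq .push (.seq p (.seq .swap (.seq q .pair))), _,
    (PolyBdd.const 4).add (hT.add ((PolyBdd.const 15).add (hT'.add (.const 8)))),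
    fun a s => (Program.runsWithin_push ..).seq <| (hp a _).seq <|
      (Program.runsWithin_swap ..).seq <| (hq a _).seq <| Program.runsWithin_pair ..⟩

@[fun_prop]
protected theorem PolyTime.fst {f : α → β × γ} (hf : PolyTime f) : PolyTime (fun a => (f a).1) :=
  hf.of_eval (.hd (.var 0)) (fun _ _ => rfl) (hf.polyBdd_size.mono fun a => by
    rw [size_prod]; omega)

@[fun_prop]
protected theorem PolyTime.snd {f : α → β × γ} (hf : PolyTime f) : PolyTime (fun a => (f a).2) :=
  hf.of_eval (.tl (.var 0)) (fun _ _ => rfl) (hf.polyBdd_size.mono fun a => by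
    rw [size_prod]; omega)

instance (P : α → Prop) : Encoded {a // P a} where
  encode a := encode a.1
  size a := size a.1

@[fun_prop]
protected theorem PolyTime.subtype_val {P : β → Prop} {f : α → {b // P b}} (hf : PolyTime f) :
    PolyTime (fun a => (f a).1) :=
  hf

instance : Encoded Bool where
  encode := .ofBool
  size _ := 1

theorem PolyTime.cond_subtype {c : α → Bool} {f g : α → β} (hc : PolyTime c)
    (hf : PolyTime fun a : {a // c a = true} => f a)
    (hg : PolyTime fun a : {a // c a = false} => g a) :
    PolyTime (fun a => bif c a then f a else g a) := by
  obtain ⟨-, r, T, hT, hr⟩ := hc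
  obtain ⟨⟨k, hk⟩, p, Tp, ⟨d, hTp⟩, hp⟩ := hf
  obtain ⟨⟨l, hl⟩, q, Tq, ⟨e, hTq⟩, hq⟩ := hg
  have poly (m : ℕ) : PolyBdd fun a : α => (size a + 2) ^ m := ⟨m, fun _ => le_rfl⟩
  refine ⟨((poly k).add (poly l)).mono fun a => ?_,
    .seq .push (.seq r (.ite (.var 0) (.seq .pop p) (.seq .pop q))), _,
    (PolyBdd.const 4).add (hT.add ((PolyBdd.const 2).add
      ((PolyBdd.const 6).add ((poly d).add (poly e))))), fun a s =>
    (Program.runsWithin_push ..).seq <| (hr a _).seq ?_⟩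
  · cases ha : c a <;> simp only [ha, cond_false, cond_true]
    · exact (hl ⟨a, ha⟩).trans (Nat.le_add_left _ _)
    · exact (hk ⟨a, ha⟩).trans (Nat.le_add_right _ _)
  · cases ha : c a <;> simp only [ha, cond_false, cond_true]
    · exact .ite_false rfl ((Program.runsWithin_pop ..).seq
        ((hq ⟨a, ha⟩ s).mono ((hTq ⟨a, ha⟩).trans (Nat.le_add_left _ _))))
    · exact .ite_true nofun ((Program.runsWithin_pop ..).seq
        ((hp ⟨a, ha⟩ s).mono ((hTp ⟨a, ha⟩).trans (Nat.le_add_right _ _))))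

@[fun_prop]
protected theorem PolyTime.cond {c : α → Bool} {f g : α → β} (hc : PolyTime c) (hf : PolyTime f)
    (hg : PolyTime g) : PolyTime (fun a => bif c a then f a else g a) :=
  hc.cond_subtype (hf.comp (.subtype_val .id)) (hg.comp (.subtype_val .id))

end PolyTime

/-! ### A library of polynomial-time functions -/

section Folds

variable {α β : Type*}

theorem foldl_and (l : List β) (p : β → Bool) (b : Bool) :
    l.foldl (fun c x => c && p x) b = (b && l.all p) := by
  induction l generalizing b with
  | nil => simp
  | cons x l ih => rw [List.foldl_cons, ih, List.all_cons, Bool.and_assoc]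

theorem foldl_append_length (l : List β) :
    l.foldl (fun (acc : List ℕ) _ => acc ++ [acc.length]) [] = List.range l.length := by
  induction l using List.reverseRecOn with
  | nil => rfl
  | append_singleton l b ih => simp [ih, List.range_succ]

theorem foldl_tail (l : List α) (l' : List β) :
    l.foldl (fun acc _ => acc.tail) l' = l'.drop l.length := by
  induction l generalizing l' with
  | nil => rfl
  | cons a l ih => rw [List.foldl_cons, ih, List.length_cons, List.drop_tail]

end Folds

section Lists

variable {α β γ : Type} [Encoded α] [Encoded β] [Encoded γ]

instance : Encoded (List β) where
  encode l := .ofList (l.map encode)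
  size l := (l.map fun b => size b + 1).sum + 1

theorem size_list (l : List β) : size l = (l.map fun b => size b + 1).sum + 1 := rfl

theorem size_cons (b : β) (l : List β) : size (b :: l) = size b + 1 + size l := by
  simp [size_list, add_assoc]

theorem size_append (l l' : List β) : size (l ++ l') + 1 = size l + size l' := by
  simp [size_list]
  omega

theorem size_reverse (l : List β) : size l.reverse = size l := by
  simp [size_list]

theorem size_le_of_sublist {l l' : List β} (h : l.Sublist l') : size l ≤ size l' :=
  Nat.succ_le_succ ((h.map _).sum_le_sum fun _ _ => Nat.zero_le _)

theorem size_le_of_mem {l : List β} {b : β} (h : b ∈ l) : size b ≤ size l := by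
  have := size_le_of_sublist (List.singleton_sublist.2 h)
  rw [size_cons] at this
  omega

theorem size_le_of_forall_mem {l : List β} {k : ℕ} (h : ∀ b ∈ l, size b ≤ k) :
    size l ≤ l.length * (k + 1) + 1 := by
  rw [size_list]
  have := List.sum_le_card_nsmul (l.map fun b => size b + 1) (k + 1) (by simpa using h)
  simpa using this

theorem length_lt_size (l : List β) : l.length < size l := by
  have := List.card_nsmul_le_sum (l.map fun b => size b + 1) 1 (by simp)
  simp only [List.length_map, smul_eq_mul, mul_one] at this
  rw [size_list]
  omega

@[fun_prop]
protected theorem PolyTime.list_cons {f : α → β} {g : α → List β} (hf : PolyTime f)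
    (hg : PolyTime g) : PolyTime (fun a => f a :: g a) :=
  (hf.prodMk hg).of_eval (.var 0) (fun _ _ => rfl)
    ((hf.prodMk hg).polyBdd_size.mono fun a => by rw [size_prod, size_cons]; dsimp only; omega)

@[fun_prop]
protected theorem PolyTime.tail {f : α → List β} (hf : PolyTime f) :
    PolyTime (fun a => (f a).tail) :=
  hf.of_eval (.tl (.var 0)) (fun a _ => by cases h : f a <;> rw [Term.eval] <;> rfl)
    (hf.polyBdd_size.mono fun a => size_le_of_sublist (f a).tail_sublist)

/-- The state of the loop is the triple of the remaining list, the accumulated value, and `a`. -/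
theorem Program.runsWithin_loop_foldl {p : Program} {h : γ → β → γ} {a : α} {s : Data} {T : ℕ}
    (l : List β) (c : γ)
    (hp : ∀ l₁ b l₂, l = l₁ ++ b :: l₂ →
      p.RunsWithin (store (encode (b :: l₂, l₁.foldl h c, a)) s)
        (store (encode (l₂, h (l₁.foldl h c) b, a)) s) T) :
    (Program.loop (.hd (.var 0)) p).RunsWithin (store (encode (l, c, a)) s)
      (store (encode (([] : List β), l.foldl h c, a)) s) ((l.length + 1) * (T + 3)) := by
  induction l generalizing c with
  | nil => exact (RunsWithin.loop_false rfl).mono (by simp [Term.cost])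
  | cons b l ih =>
    have h_ne_nil : Term.eval (store (encode (b :: l, c, a)) s) (.hd (.var 0)) ≠ .nil := nofun
    refine (RunsWithin.loop_true h_ne_nil (hp [] b l rfl) (ih (h c b) fun l₁ b' l₂ hl =>
      hp (b :: l₁) b' l₂ (congr_arg _ hl))).mono (le_of_eq ?_)
    simp only [Term.cost, List.length_cons]
    ring

protected theorem PolyTime.foldl {f : α → List β} {g : α → γ} {h : α → γ → β → γ}
    (hf : PolyTime f) (hg : PolyTime g) (hh : PolyTime fun x : α × γ × β => h x.1 x.2.1 x.2.2)
    {U : α → ℕ} (hU : PolyBdd U) (h_size : ∀ a l, l <+: f a → size (l.foldl (h a) (g a)) ≤ U a) :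
    PolyTime (fun a => (f a).foldl (h a) (g a)) := by
  have h_body : PolyTime fun x : (β × List β) × γ × α =>
      (x.1.2, h x.2.2 x.2.1 x.1.1, x.2.2) := by
    have := hh.comp (f := fun x : (β × List β) × γ × α => (x.2.2, x.2.1, x.1.1)) (by fun_prop)
    fun_prop
  obtain ⟨-, p, T, hT, hp⟩ := hf.prodMk (hg.prodMk PolyTime.id)
  obtain ⟨-, q, T', ⟨c, hT'⟩, hq⟩ := h_body
  have h_step (a : α) (l₁ : List β) (b : β) (l₂ : List β) (hl : f a = l₁ ++ b :: l₂) :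
      T' ((b, l₂), l₁.foldl (h a) (g a), a) ≤ (size (f a) + U a + size a + 4) ^ c := by
    refine (hT' _).trans (Nat.pow_le_pow_left ?_ c)
    have h_acc := h_size a l₁ (hl ▸ List.prefix_append ..)
    have h_rest : size (b :: l₂) ≤ size (f a) :=
      size_le_of_sublist (hl ▸ List.sublist_append_right ..)
    rw [size_cons] at h_rest
    simp only [size_prod]
    omega
  refine ⟨hU.mono fun a => h_size a _ List.prefix_rfl,
    .seq p (.seq (.loop (.hd (.var 0)) q) (.assign 0 (.hd (.tl (.var 0))))),
    fun a => T a + ((size (f a) + 1) * ((size (f a) + U a + size a + 4) ^ c + 3) + 4),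
    hT.add (((hf.polyBdd_size.add (.const 1)).mul ((((hf.polyBdd_size.add hU).add .size).add
      (.const 4)).pow c |>.add (.const 3))).add (.const 4)), fun a s => ?_⟩
  have h_loop := Program.runsWithin_loop_foldl (s := s) (f a) (g a) fun l₁ b l₂ hl =>
    (hq ((b, l₂), l₁.foldl (h a) (g a), a) s).mono (h_step a l₁ b l₂ hl)
  refine (hp a s).seq (.seq (h_loop.mono ?_) (Program.runsWithin_assign_zero ..))
  have := length_lt_size (f a)
  gcongr

@[fun_prop]
protected theorem PolyTime.not {f : α → Bool} (hf : PolyTime f) : PolyTime (fun a => !f a) := by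
  have : PolyTime fun a => bif f a then false else true := by fun_prop
  simpa using this

@[fun_prop]
protected theorem PolyTime.and {f g : α → Bool} (hf : PolyTime f) (hg : PolyTime g) :
    PolyTime (fun a => f a && g a) := by
  have : PolyTime fun a => bif f a then g a else false := by fun_prop
  simpa only [Bool.cond_false_right] using this

@[fun_prop]
protected theorem PolyTime.or {f g : α → Bool} (hf : PolyTime f) (hg : PolyTime g) :
    PolyTime (fun a => f a || g a) := by
  have : PolyTime fun a => bif f a then true else g a := by fun_prop
  simpa only [Bool.cond_true_left] using this

@[fun_prop]
protected theorem PolyTime.xor {f g : α → Bool} (hf : PolyTime f) (hg : PolyTime g) :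
    PolyTime (fun a => f a ^^ g a) := by
  have : PolyTime fun a => bif f a then !g a else g a := by fun_prop
  convert this using 2 with a
  cases f a <;> simp

@[fun_prop]
protected theorem PolyTime.all {f : α → List β} {p : α → β → Bool} (hf : PolyTime f)
    (hp : PolyTime fun x : α × β => p x.1 x.2) : PolyTime (fun a => (f a).all (p a)) := by
  have h_step : PolyTime fun x : α × Bool × β => x.2.1 && p x.1 x.2.2 :=
    .and (by fun_prop) (hp.comp (f := fun x : α × Bool × β => (x.1, x.2.2)) (by fun_prop))
  have := hf.foldl (h := fun a c x => c && p a x) (.const true) h_step (.const 1)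
    fun _ _ _ => le_rfl
  simpa only [foldl_and, Bool.true_and] using this

@[fun_prop]
protected theorem PolyTime.any {f : α → List β} {p : α → β → Bool} (hf : PolyTime f)
    (hp : PolyTime fun x : α × β => p x.1 x.2) : PolyTime (fun a => (f a).any (p a)) := by
  have : PolyTime fun a => !(f a).all fun b => !p a b := by fun_prop
  simpa only [List.not_all_eq_any_not, Bool.not_not] using this

@[fun_prop]
protected theorem PolyTime.isEmpty {f : α → List β} (hf : PolyTime f) :
    PolyTime (fun a => (f a).isEmpty) := by
  have : PolyTime fun a => (f a).all fun _ => false := by fun_prop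
  convert this using 2 with a
  cases f a <;> simp

@[fun_prop]
protected theorem PolyTime.reverse {f : α → List β} (hf : PolyTime f) :
    PolyTime (fun a => (f a).reverse) := by
  have := hf.foldl (h := fun _ acc b => b :: acc) (.const []) (by fun_prop) hf.polyBdd_size
    fun a l hl => by
      rw [List.foldl_flip_cons_eq_append', List.append_nil, size_reverse]
      exact size_le_of_sublist hl.sublist
  simpa only [List.foldl_flip_cons_eq_append', List.append_nil] using this

@[fun_prop]
protected theorem PolyTime.append {f g : α → List β} (hf : PolyTime f) (hg : PolyTime g) :
    PolyTime (fun a => f a ++ g a) := by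
  have := hf.reverse.foldl (h := fun _ acc b => b :: acc) hg (by fun_prop)
    (hf.polyBdd_size.add hg.polyBdd_size) fun a l hl => by
      have h_append := size_append l.reverse (g a)
      have h_prefix := size_le_of_sublist hl.sublist
      rw [size_reverse] at h_append h_prefix
      rw [List.foldl_flip_cons_eq_append']
      omega
  simpa only [List.foldl_flip_cons_eq_append', List.reverse_reverse] using this

@[fun_prop]
protected theorem PolyTime.headD {f : α → List β} {g : α → β} (hf : PolyTime f)
    (hg : PolyTime g) : PolyTime (fun a => (f a).headD (g a)) := by
  have h_append : PolyTime fun a => f a ++ [g a] := by fun_prop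
  refine h_append.of_eval (.hd (.var 0)) (fun a _ => ?_) (h_append.polyBdd_size.mono fun a => ?_)
  · cases h : f a <;> rw [Term.eval] <;> rfl
  · cases h : f a <;> simp [size_cons] <;> omega

@[fun_prop]
protected theorem PolyTime.map {f : α → List β} {g : α → β → γ} (hf : PolyTime f)
    (hg : PolyTime fun x : α × β => g x.1 x.2) : PolyTime (fun a => (f a).map (g a)) := by
  obtain ⟨c, hc⟩ := hg.polyBdd_size
  have h_step : PolyTime fun x : α × List γ × β => g x.1 x.2.2 :: x.2.1 :=
    .list_cons (hg.comp (f := fun x : α × List γ × β => (x.1, x.2.2)) (by fun_prop)) (by fun_prop)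
  have := hf.foldl (h := fun a acc b => g a b :: acc) (.const []) h_step
    (U := fun a => size (f a) * ((size a + size (f a) + 3) ^ c + 1) + 1)
    ((hf.polyBdd_size.mul ((((PolyBdd.size.add hf.polyBdd_size).add (.const 3)).pow c).add
      (.const 1))).add (.const 1)) fun a l hl => by
      have h_mem : ∀ x ∈ l.map (g a), size x ≤ (size a + size (f a) + 3) ^ c := by
        rw [List.forall_mem_map]
        refine fun b hb => (hc (a, b)).trans (Nat.pow_le_pow_left ?_ c)
        have := size_le_of_mem (hl.subset hb)
        rw [size_prod]
        dsimp only
        omega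
      have h_length : l.length ≤ size (f a) := hl.length_le.trans (length_lt_size _).le
      rw [List.foldl_flip_cons_eq_append, List.append_nil, size_reverse]
      refine (size_le_of_forall_mem h_mem).trans ?_
      rw [List.length_map]
      gcongr
  simpa only [List.foldl_flip_cons_eq_append, List.append_nil, List.reverse_reverse] using
    this.reverse

theorem size_flatten_le (l : List (List β)) : size l.flatten ≤ size l := by
  induction l with
  | nil => rfl
  | cons b l ih =>
    have := size_append b l.flatten
    rw [List.flatten_cons, size_cons]
    omega

@[fun_prop]
protected theorem PolyTime.flatten {f : α → List (List β)} (hf : PolyTime f) :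
    PolyTime (fun a => (f a).flatten) := by
  have := hf.foldl (h := fun _ acc b => acc ++ b) (.const []) (by fun_prop) hf.polyBdd_size
    fun a l hl => by
      rw [List.foldl_append_eq_append, List.map_id', List.nil_append]
      exact (size_flatten_le l).trans (size_le_of_sublist hl.sublist)
  convert this using 2 with a
  rw [List.foldl_append_eq_append, List.map_id', List.nil_append]

@[fun_prop]
protected theorem PolyTime.flatMap {f : α → List β} {g : α → β → List γ} (hf : PolyTime f)
    (hg : PolyTime fun x : α × β => g x.1 x.2) : PolyTime (fun a => (f a).flatMap (g a)) :=
  (hf.map hg).flatten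

@[fun_prop]
protected theorem PolyTime.filter {f : α → List β} {p : α → β → Bool} (hf : PolyTime f)
    (hp : PolyTime fun x : α × β => p x.1 x.2) : PolyTime (fun a => (f a).filter (p a)) := by
  have : PolyTime fun a => (f a).flatMap fun b => bif p a b then [b] else [] := by fun_prop
  convert this using 2 with a
  induction f a with
  | nil => rfl
  | cons b l ih => cases h : p a b <;> simp [h, ih]

end Lists

section Numbers

variable {α β : Type} [Encoded α] [Encoded β]

instance : Encoded Unit where
  encode _ := .nil
  size _ := 0

instance : Encoded ℕ where
  encode k := encode (List.replicate k ())
  size k := k + 1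

theorem size_nat (k : ℕ) : size k = k + 1 := rfl

@[fun_prop]
protected theorem PolyTime.replicate_unit {f : α → ℕ} (hf : PolyTime f) :
    PolyTime (fun a => List.replicate (f a) ()) :=
  hf.of_eval (.var 0) (fun _ _ => rfl) (hf.polyBdd_size.mono fun a =>
    (size_list _).trans_le (by simp [size]))

@[fun_prop]
protected theorem PolyTime.length {f : α → List β} (hf : PolyTime f) :
    PolyTime (fun a => (f a).length) := by
  have h_map : PolyTime fun a => (f a).map fun _ => () := by fun_prop
  refine h_map.of_eval (.var 0) (fun a _ => ?_) (hf.polyBdd_size.mono fun a => length_lt_size _)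
  exact congr_arg encode List.map_const'

@[fun_prop]
protected theorem PolyTime.add {f g : α → ℕ} (hf : PolyTime f) (hg : PolyTime g) :
    PolyTime (fun a => f a + g a) := by
  have : PolyTime fun a => (List.replicate (f a) () ++ List.replicate (g a) ()).length := by
    fun_prop
  simpa only [List.length_append, List.length_replicate] using this

@[fun_prop]
protected theorem PolyTime.range {f : α → ℕ} (hf : PolyTime f) :
    PolyTime (fun a => List.range (f a)) := by
  have := hf.replicate_unit.foldl (h := fun _ acc _ => acc ++ [acc.length]) (.const [])
    (by fun_prop) (U := fun a => size (f a) * (size (f a) + 1) + 1)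
    ((hf.polyBdd_size.mul (hf.polyBdd_size.add (.const 1))).add (.const 1)) fun a l hl => by
      have h_length : l.length ≤ f a := hl.length_le.trans_eq (List.length_replicate ..)
      have h_mem : ∀ i ∈ List.range l.length, size i ≤ size (f a) := fun i hi => by
        have := List.mem_range.1 hi
        simp only [size_nat]
        omega
      rw [foldl_append_length]
      refine (size_le_of_forall_mem h_mem).trans ?_
      rw [List.length_range]
      gcongr
      exact h_length.trans (Nat.le_succ _)
  simpa only [foldl_append_length, List.length_replicate] using this

@[fun_prop]
protected theorem PolyTime.drop {f : α → ℕ} {g : α → List β} (hf : PolyTime f)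
    (hg : PolyTime g) : PolyTime (fun a => (g a).drop (f a)) := by
  have := hf.replicate_unit.foldl (h := fun _ acc _ => acc.tail) hg (by fun_prop)
    hg.polyBdd_size fun a l _ => by
      rw [foldl_tail]
      exact size_le_of_sublist (List.drop_sublist ..)
  simpa only [foldl_tail, List.length_replicate] using this

@[fun_prop]
protected theorem PolyTime.getD {f : α → ℕ} {g : α → List β} {d : α → β} (hf : PolyTime f)
    (hg : PolyTime g) (hd : PolyTime d) : PolyTime (fun a => (g a).getD (f a) (d a)) := by
  have : PolyTime fun a => ((g a).drop (f a)).headD (d a) := by fun_prop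
  simpa only [List.headD_eq_head?_getD, List.head?_drop, ← List.getD_eq_getElem?_getD] using this

@[fun_prop]
protected theorem PolyTime.ble {f g : α → ℕ} (hf : PolyTime f) (hg : PolyTime g) :
    PolyTime (fun a => (f a).ble (g a)) := by
  have : PolyTime fun a => ((List.replicate (f a) ()).drop (g a)).isEmpty := by fun_prop
  convert this using 2 with a
  rw [Bool.eq_iff_iff, Nat.ble_eq]
  simp [Nat.sub_eq_zero_iff_le]

@[fun_prop]
protected theorem PolyTime.beq {f g : α → ℕ} (hf : PolyTime f) (hg : PolyTime g) :
    PolyTime (fun a => (f a).beq (g a)) := by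
  have : PolyTime fun a => (f a).ble (g a) && (g a).ble (f a) := by fun_prop
  convert this using 2 with a
  rw [Bool.eq_iff_iff, Bool.and_eq_true, Nat.ble_eq, Nat.ble_eq, Nat.beq_eq, le_antisymm_iff]

@[fun_prop]
protected theorem PolyTime.countP {f : α → List β} {p : α → β → Bool} (hf : PolyTime f)
    (hp : PolyTime fun x : α × β => p x.1 x.2) : PolyTime (fun a => (f a).countP (p a)) := by
  have : PolyTime fun a => ((f a).filter (p a)).length := by fun_prop
  simpa only [List.countP_eq_length_filter] using this

@[fun_prop]
protected theorem PolyTime.list_sum {f : α → List ℕ} (hf : PolyTime f) :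
    PolyTime (fun a => (f a).sum) := by
  have : PolyTime fun a => ((f a).flatMap fun k => List.replicate k ()).length := by fun_prop
  simpa only [List.length_flatMap, List.length_replicate, List.map_id'] using this

end Numbers

/-! ### The algorithm -/

/-- The entry of a list of truth values. The lists that represent sets of vertices (characteristic
vectors) and cuts (sides of the vertices) are read with this function; the value outside of the
list is `false`. -/
def bit (l : List Bool) (i : ℕ) : Bool := l.getD i false

/-- The entry of a matrix of truth values, given by the list of its rows. -/
def entry (M : List (List Bool)) (i j : ℕ) : Bool := bit (M.getD i []) j

/-- The degree of `v` in the graph with adjacency matrix `M`. -/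
def degreeAt (M : List (List Bool)) (v : ℕ) : ℕ :=
  (List.range M.length).countP fun u => entry M v u

/-- The number of neighbors of `v` in `A` that the cut `p` separates from `v`. -/
def crossingsAt (M : List (List Bool)) (A p : List Bool) (v : ℕ) : ℕ :=
  (List.range M.length).countP fun u => bit A u && (entry M v u && (bit p u ^^ bit p v))

/-- Whether `v` is a vertex of `A` with a neighbor outside of `A`. -/
def isBoundary (M : List (List Bool)) (A : List Bool) (v : ℕ) : Bool :=
  bit A v && (List.range M.length).any fun u => entry M v u && !bit A u

/-- Whether the cut `p` is stable for the vertices of `A` that are not on the boundary. -/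
def stableInside (M : List (List Bool)) (A p : List Bool) : Bool :=
  (List.range M.length).all fun v => !bit A v || (isBoundary M A v ||
    (degreeAt M v).ble (crossingsAt M A p v + crossingsAt M A p v))

/-- Twice the number of edges inside `A` that the cut `p` cuts. -/
def weightInside (M : List (List Bool)) (A p : List Bool) : ℕ :=
  (((List.range M.length).filter fun v => bit A v).map fun v => crossingsAt M A p v).sum

/-- Whether the restrictions of the cuts `p` and `q` to `A` can be exchanged without any effect
outside of `A`. -/
def interchangeable (M : List (List Bool)) (A p q : List Bool) : Bool :=
  !(stableInside M A p ^^ stableInside M A q) &&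
    ((weightInside M A p).beq (weightInside M A q) &&
      (List.range M.length).all fun v => !isBoundary M A v ||
        (!(bit p v ^^ bit q v) && (crossingsAt M A p v).beq (crossingsAt M A q v)))

/-- Keeps one cut of each class of interchangeable cuts. -/
def prune (M : List (List Bool)) (A : List Bool) (L : List (List Bool)) : List (List Bool) :=
  L.foldl (fun acc p => bif acc.any fun q => interchangeable M A q p then acc else p :: acc) []

/-- The cut that agrees with `p` on `A` and with `q` elsewhere. -/
def override (M : List (List Bool)) (A p q : List Bool) : List Bool :=
  (List.range M.length).map fun v => bif bit A v then bit p v else bit q v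

/-- The union of two sets of vertices. -/
def union (M : List (List Bool)) (A B : List Bool) : List Bool :=
  (List.range M.length).map fun v => bit A v || bit B v

/-- A table of the dynamic program: a node of the tree, a set of vertices, and a list of cuts that
represents all cuts as far as their restrictions to the set of vertices are concerned. -/
structure Table where
  node : ℕ
  vertices : List Bool
  cuts : List (List Bool)

/-- The table of the union of the sets of vertices of `x` and `y`, at the node of `y`. -/
def Table.merge (M : List (List Bool)) (x y : Table) : Table where
  node := y.node
  vertices := union M x.vertices y.vertices
  cuts := prune M (union M x.vertices y.vertices)
    (x.cuts.flatMap fun p => y.cuts.map fun q => override M x.vertices p q)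

/-- The list with the value `b` at all vertices. -/
def constList (M : List (List Bool)) (b : Bool) : List Bool :=
  (List.range M.length).map fun _ => b

/-- The table of the set `{v}`; its node is of no importance. -/
def singletonTable (M : List (List Bool)) (v : ℕ) : Table where
  node := 0
  vertices := (List.range M.length).map fun u => u.beq v
  cuts := [constList M false, constList M true]

/-- Adds the vertex `v` to the tables of the nodes whose bags contain it. -/
def introduce (M B : List (List Bool)) (l : List Table) (v : ℕ) : List Table :=
  l.map fun x => bif entry B x.node v then (singletonTable M v).merge M x else x

/-- Merges the table `x` of the list into the table `y` of the list. -/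
def contract (M : List (List Bool)) (l : List Table) (x y : Table) : List Table :=
  (l.filter fun z => !z.node.beq x.node).map fun z =>
    bif z.node.beq y.node then x.merge M z else z

/-- The pairs of tables with adjacent nodes of which the first has no other neighbor among the
nodes of the list. -/
def leafPairs (T : List (List Bool)) (l : List Table) : List (Table × Table) :=
  l.flatMap fun x => (l.filter fun y => entry T x.node y.node &&
    l.all fun z => !entry T x.node z.node || z.node.beq y.node).map fun y => (x, y)

/-- Merges the table of a leaf of the remaining tree, if there is one, into that of its neighbor. -/
def contractLeaf (M T : List (List Bool)) (l : List Table) : List Table :=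
  ((leafPairs T l).map fun e => contract M l e.1 e.2).headD l

/-- The stable cuts of a table that have minimum weight among the stable cuts of the table, if the
set of vertices of the table consists of all vertices. -/
def bestCuts (M : List (List Bool)) (x : Table) : List (List Bool) :=
  x.cuts.filter fun p => stableInside M x.vertices p && x.cuts.all fun q =>
    !stableInside M x.vertices q || (weightInside M x.vertices p).ble (weightInside M x.vertices q)

/-- Whether all degrees are at most one. -/
def isMatching (M : List (List Bool)) : Bool :=
  (List.range M.length).all fun v => (degreeAt M v).ble 1

/-- A cut of all edges, if all degrees are at most one. -/
def matchingCut (M : List (List Bool)) : List Bool :=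
  (List.range M.length).map fun v => (List.range M.length).any fun u => !v.ble u && entry M v u

/-- An instance: the adjacency matrices of the graph and of the tree, and the bags. -/
structure Input where
  graph : List (List Bool)
  tree : List (List Bool)
  bags : List (List Bool)

/-- The tables of the sets of the vertices less than `k` in the bags. -/
def partialBagTables (x : Input) (k : ℕ) : List Table :=
  (List.range k).foldl (introduce x.graph x.bags) <| (List.range x.tree.length).map fun t =>
    { node := t, vertices := constList x.graph false, cuts := [constList x.graph false] }

/-- The tables that remain after the contraction of `k` leaves of the tree. -/
def contractedTables (x : Input) (k : ℕ) : List Table :=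
  (List.range k).foldl (fun l _ => contractLeaf x.graph x.tree l)
    (partialBagTables x x.graph.length)

/-- The algorithm for Unweighted Min Stable Cut. Graphs of maximum degree at most one are treated
separately, since for them the number of classes of interchangeable cuts is not bounded in terms
of a power of the maximum degree. -/
def solve (x : Input) : List Bool :=
  bif isMatching x.graph then matchingCut x.graph else
    ((contractedTables x x.tree.length).flatMap (bestCuts x.graph)).headD []

/-! ### The running time of the algorithm -/

section RunningTime

instance : Encoded Table where
  encode x := encode (x.node, x.vertices, x.cuts)
  size x := size (x.node, x.vertices, x.cuts)

instance : Encoded Input where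
  encode x := encode (x.graph, x.tree, x.bags)
  size x := size (x.graph, x.tree, x.bags)

theorem size_table (x : Table) : size x = size (x.node, x.vertices, x.cuts) := rfl

theorem size_input (x : Input) : size x = size (x.graph, x.tree, x.bags) := rfl

variable {α : Type} [Encoded α] {M T B L : α → List (List Bool)} {A p q : α → List Bool}
  {u v : α → ℕ} {b : α → Bool} {x y : α → Table} {l : α → List Table} {z : α → Input}

@[fun_prop]
theorem PolyTime.tableMk (hv : PolyTime v) (hA : PolyTime A) (hL : PolyTime L) :
    PolyTime fun a => Table.mk (v a) (A a) (L a) :=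
  (hv.prodMk (hA.prodMk hL)).of_eval (.var 0) (fun _ _ => rfl)
    (hv.prodMk (hA.prodMk hL)).polyBdd_size

theorem PolyTime.tableToProd (hx : PolyTime x) :
    PolyTime fun a => ((x a).node, (x a).vertices, (x a).cuts) :=
  hx.of_eval (.var 0) (fun _ _ => rfl) hx.polyBdd_size

@[fun_prop]
theorem PolyTime.node (hx : PolyTime x) : PolyTime fun a => (x a).node := hx.tableToProd.fst

@[fun_prop]
theorem PolyTime.vertices (hx : PolyTime x) : PolyTime fun a => (x a).vertices :=
  hx.tableToProd.snd.fst

@[fun_prop]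
theorem PolyTime.cuts (hx : PolyTime x) : PolyTime fun a => (x a).cuts := hx.tableToProd.snd.snd

theorem PolyTime.inputToProd (hz : PolyTime z) :
    PolyTime fun a => ((z a).graph, (z a).tree, (z a).bags) :=
  hz.of_eval (.var 0) (fun _ _ => rfl) hz.polyBdd_size

@[fun_prop]
theorem PolyTime.graph (hz : PolyTime z) : PolyTime fun a => (z a).graph := hz.inputToProd.fst

@[fun_prop]
theorem PolyTime.tree (hz : PolyTime z) : PolyTime fun a => (z a).tree := hz.inputToProd.snd.fst

@[fun_prop]
theorem PolyTime.bags (hz : PolyTime z) : PolyTime fun a => (z a).bags := hz.inputToProd.snd.snd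

@[fun_prop]
protected theorem PolyTime.bit (hA : PolyTime A) (hv : PolyTime v) :
    PolyTime fun a => bit (A a) (v a) := by
  unfold bit; fun_prop

@[fun_prop]
protected theorem PolyTime.entry (hM : PolyTime M) (hv : PolyTime v) (hu : PolyTime u) :
    PolyTime fun a => entry (M a) (v a) (u a) := by
  unfold entry; fun_prop

@[fun_prop]
protected theorem PolyTime.degreeAt (hM : PolyTime M) (hv : PolyTime v) :
    PolyTime fun a => degreeAt (M a) (v a) := by
  unfold degreeAt; fun_prop

@[fun_prop]
protected theorem PolyTime.crossingsAt (hM : PolyTime M) (hA : PolyTime A) (hp : PolyTime p)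
    (hv : PolyTime v) : PolyTime fun a => crossingsAt (M a) (A a) (p a) (v a) := by
  unfold crossingsAt; fun_prop

@[fun_prop]
protected theorem PolyTime.isBoundary (hM : PolyTime M) (hA : PolyTime A) (hv : PolyTime v) :
    PolyTime fun a => isBoundary (M a) (A a) (v a) := by
  unfold isBoundary; fun_prop

@[fun_prop]
protected theorem PolyTime.stableInside (hM : PolyTime M) (hA : PolyTime A) (hp : PolyTime p) :
    PolyTime fun a => stableInside (M a) (A a) (p a) := by
  unfold stableInside; fun_prop

@[fun_prop]
protected theorem PolyTime.weightInside (hM : PolyTime M) (hA : PolyTime A) (hp : PolyTime p) :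
    PolyTime fun a => weightInside (M a) (A a) (p a) := by
  unfold weightInside; fun_prop

@[fun_prop]
protected theorem PolyTime.interchangeable (hM : PolyTime M) (hA : PolyTime A) (hp : PolyTime p)
    (hq : PolyTime q) : PolyTime fun a => interchangeable (M a) (A a) (p a) (q a) := by
  unfold interchangeable; fun_prop

theorem prune_append_singleton (M : List (List Bool)) (A : List Bool) (L : List (List Bool))
    (p : List Bool) : prune M A (L ++ [p]) =
      bif (prune M A L).any fun q => interchangeable M A q p then prune M A L
      else p :: prune M A L := by
  rw [prune, List.foldl_append, ← prune, List.foldl_cons, List.foldl_nil]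

theorem reverse_prune_sublist (M : List (List Bool)) (A : List Bool) (L : List (List Bool)) :
    (prune M A L).reverse.Sublist L := by
  induction L using List.reverseRecOn with
  | nil => exact .slnil
  | append_singleton L p ih =>
    rw [prune_append_singleton]
    cases (prune M A L).any _
    · simpa using ih
    · exact ih.trans (List.sublist_append_left _ _)

@[fun_prop]
protected theorem PolyTime.prune (hM : PolyTime M) (hA : PolyTime A) (hL : PolyTime L) :
    PolyTime fun a => prune (M a) (A a) (L a) := by
  refine hL.foldl (h := fun a acc p => bif acc.any fun q => interchangeable (M a) (A a) q p
    then acc else p :: acc) (.const _) (by fun_prop) hL.polyBdd_size fun a l hl => ?_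
  have h_prune := size_le_of_sublist (reverse_prune_sublist (M a) (A a) l)
  rw [size_reverse] at h_prune
  exact h_prune.trans (size_le_of_sublist hl.sublist)

@[fun_prop]
protected theorem PolyTime.override (hM : PolyTime M) (hA : PolyTime A) (hp : PolyTime p)
    (hq : PolyTime q) : PolyTime fun a => override (M a) (A a) (p a) (q a) := by
  unfold override; fun_prop

@[fun_prop]
protected theorem PolyTime.union (hM : PolyTime M) (hp : PolyTime p) (hq : PolyTime q) :
    PolyTime fun a => union (M a) (p a) (q a) := by
  unfold union; fun_prop

@[fun_prop]
protected theorem PolyTime.merge (hM : PolyTime M) (hx : PolyTime x) (hy : PolyTime y) :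
    PolyTime fun a => (x a).merge (M a) (y a) := by
  unfold Table.merge; fun_prop

@[fun_prop]
protected theorem PolyTime.constList (hM : PolyTime M) (hb : PolyTime b) :
    PolyTime fun a => constList (M a) (b a) := by
  unfold constList; fun_prop

@[fun_prop]
protected theorem PolyTime.singletonTable (hM : PolyTime M) (hv : PolyTime v) :
    PolyTime fun a => singletonTable (M a) (v a) := by
  unfold singletonTable; fun_prop

@[fun_prop]
protected theorem PolyTime.introduce (hM : PolyTime M) (hB : PolyTime B) (hl : PolyTime l)
    (hv : PolyTime v) : PolyTime fun a => introduce (M a) (B a) (l a) (v a) := by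
  unfold introduce; fun_prop

@[fun_prop]
protected theorem PolyTime.contract (hM : PolyTime M) (hl : PolyTime l) (hx : PolyTime x)
    (hy : PolyTime y) : PolyTime fun a => contract (M a) (l a) (x a) (y a) := by
  unfold contract; fun_prop

@[fun_prop]
protected theorem PolyTime.leafPairs (hT : PolyTime T) (hl : PolyTime l) :
    PolyTime fun a => leafPairs (T a) (l a) := by
  unfold leafPairs; fun_prop

@[fun_prop]
protected theorem PolyTime.contractLeaf (hM : PolyTime M) (hT : PolyTime T) (hl : PolyTime l) :
    PolyTime fun a => contractLeaf (M a) (T a) (l a) := by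
  unfold contractLeaf; fun_prop

@[fun_prop]
protected theorem PolyTime.bestCuts (hM : PolyTime M) (hx : PolyTime x) :
    PolyTime fun a => bestCuts (M a) (x a) := by
  unfold bestCuts; fun_prop

@[fun_prop]
protected theorem PolyTime.isMatching (hM : PolyTime M) : PolyTime fun a => isMatching (M a) := by
  unfold isMatching; fun_prop

@[fun_prop]
protected theorem PolyTime.matchingCut (hM : PolyTime M) :
    PolyTime fun a => matchingCut (M a) := by
  unfold matchingCut; fun_prop

/-- The number `s` bounds the sizes of the intermediate lists of tables. -/
structure Affordable (x : Input) (s : ℕ) : Prop where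
  size_partialBagTables_le : ∀ k ≤ x.graph.length, size (partialBagTables x k) ≤ s
  size_contractedTables_le : ∀ k ≤ x.tree.length, size (contractedTables x k) ≤ s

/-- Instances together with a bound for the sizes of the intermediate lists of tables. This bound
counts as a part of the size of the instance, so that `solve` runs in polynomial time. -/
structure BudgetedInput where
  input : Input
  budget : ℕ
  affordable : isMatching input.graph = false → Affordable input budget

instance : Encoded BudgetedInput where
  encode x := encode x.input
  size x := size x.input + x.budget

@[fun_prop]
theorem PolyTime.input {f : α → BudgetedInput} (hf : PolyTime f) :
    PolyTime fun a => (f a).input :=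
  hf.of_eval (.var 0) (fun _ _ => rfl) (hf.polyBdd_size.mono fun _ => Nat.le_add_right _ _)

theorem eq_range_of_prefix {l : List ℕ} {n : ℕ} (h : l <+: List.range n) :
    l = List.range l.length ∧ l.length ≤ n := by
  have h_length : l.length ≤ n := h.length_le.trans_eq List.length_range
  refine ⟨?_, h_length⟩
  conv_lhs => rw [List.prefix_iff_eq_take.1 h, List.take_range, min_eq_left h_length]

theorem PolyTime.polyBdd_budget {f : α → BudgetedInput} (hf : PolyTime f) :
    PolyBdd fun a => (f a).budget :=
  hf.polyBdd_size.mono fun _ => Nat.le_add_left _ _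

theorem PolyTime.partialBagTables_length {f : α → BudgetedInput} (hf : PolyTime f)
    (h : ∀ a, isMatching (f a).input.graph = false) :
    PolyTime fun a => partialBagTables (f a).input (f a).input.graph.length := by
  refine PolyTime.foldl (h := fun a => introduce (f a).input.graph (f a).input.bags)
    (by fun_prop) (by fun_prop) (by fun_prop) hf.polyBdd_budget fun a l hl => ?_
  obtain ⟨h_range, h_length⟩ := eq_range_of_prefix hl
  rw [h_range]
  exact ((f a).affordable (h a)).size_partialBagTables_le _ h_length

theorem PolyTime.contractedTables_length {f : α → BudgetedInput} (hf : PolyTime f)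
    (h : ∀ a, isMatching (f a).input.graph = false) :
    PolyTime fun a => contractedTables (f a).input (f a).input.tree.length := by
  refine PolyTime.foldl
    (h := fun a l _ => contractLeaf (f a).input.graph (f a).input.tree l)
    (by fun_prop) (.partialBagTables_length hf h) (by fun_prop) hf.polyBdd_budget fun a l hl => ?_
  obtain ⟨h_range, h_length⟩ := eq_range_of_prefix hl
  rw [h_range]
  exact ((f a).affordable (h a)).size_contractedTables_le _ h_length

protected theorem PolyTime.solve : PolyTime fun x : BudgetedInput => solve x.input := by
  refine PolyTime.cond_subtype (by fun_prop) (by fun_prop) ?_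
  have h_contracted := PolyTime.contractedTables_length
    (f := fun x : {x : BudgetedInput // isMatching x.input.graph = false} => x.1)
    (.subtype_val .id) Subtype.property
  fun_prop

theorem exists_program_solve : ∃ (p : Program) (c : ℕ), ∀ (x : Input) (s : ℕ),
    (isMatching x.graph = false → Affordable x s) →
      ∃ t ≤ (size x + s + 2) ^ c, p.Outputs (encode x) (encode (solve x)) t := by
  obtain ⟨-, p, T, ⟨c, hT⟩, hp⟩ := PolyTime.solve
  refine ⟨p, c, fun x s hs => ?_⟩
  obtain ⟨t, ht, h_runs⟩ := hp ⟨x, s, hs⟩ .nil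
  have h_init : store (encode x) .nil = initStore (encode x) := by
    funext i
    rcases i with _ | _ | i <;> rfl
  exact ⟨t, ht.trans (hT _), _, h_init ▸ h_runs, rfl⟩

end RunningTime

/-! ### Cuts and their restrictions to sets of vertices -/

section Cuts

variable {V : Type*} [Fintype V] {G : SimpleGraph V} [DecidableRel G.Adj] {w : Sym2 V → ℕ}

theorem isStableAt_iff {f : V → Bool} {v : V} :
    IsStableAt G w f v ↔ weightedDegree G w v ≤ 2 * crossingWeight G w f v := by
  rw [IsStableAt, div_le_iff₀ (by norm_num), mul_comm]
  norm_cast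

theorem crossingWeight_le_weightedDegree (f : V → Bool) (v : V) :
    crossingWeight G w f v ≤ weightedDegree G w v :=
  Finset.sum_le_sum_of_subset (Finset.filter_subset _ _)

variable [DecidableEq V]

theorem crossingWeight_eq_sum_incidenceFinset (f : V → Bool) (v : V) :
    crossingWeight G w f v =
      ∑ e ∈ G.incidenceFinset v with (∃ a ∈ e, ∃ b ∈ e, f a ≠ f b), w e := by
  refine Finset.sum_bij (fun u _ => s(v, u)) (fun u hu => ?_) (fun _ _ _ _ => Sym2.congr_right.1)
    (fun e he => ?_) (fun _ _ => rfl)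
  · simp only [Finset.mem_filter, SimpleGraph.mem_neighborFinset] at hu
    rw [Finset.mem_filter, SimpleGraph.mem_incidenceFinset]
    exact ⟨⟨hu.1, Sym2.mem_mk_left v u⟩, u, Sym2.mem_mk_right v u, v, Sym2.mem_mk_left v u, hu.2⟩
  · simp only [Finset.mem_filter, SimpleGraph.mem_incidenceFinset] at he
    obtain ⟨⟨h_edge, h_mem⟩, a, ha, b, hb, hab⟩ := he
    obtain ⟨u, rfl⟩ := h_mem
    refine ⟨u, ?_, rfl⟩
    have h_ne : f u ≠ f v := by
      rcases Sym2.mem_iff.1 ha with rfl | rfl <;> rcases Sym2.mem_iff.1 hb with rfl | rfl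
      exacts [absurd rfl hab, hab.symm, hab, absurd rfl hab]
    simpa using ⟨h_edge, h_ne⟩

theorem sum_crossingWeight (f : V → Bool) :
    ∑ v, crossingWeight G w f v = 2 * cutWeight G w f := by
  calc ∑ v, crossingWeight G w f v
      = ∑ e ∈ G.edgeFinset with (∃ a ∈ e, ∃ b ∈ e, f a ≠ f b), ∑ _v ∈ e.toFinset, w e := by
        simp only [crossingWeight_eq_sum_incidenceFinset]
        refine Finset.sum_comm' fun v e => ?_
        rw [Finset.mem_filter, Finset.mem_filter, SimpleGraph.mem_incidenceFinset,
          SimpleGraph.mem_edgeFinset, Sym2.mem_toFinset]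
        exact ⟨fun ⟨_, ⟨he, hv⟩, h⟩ => ⟨hv, he, h⟩,
          fun ⟨hv, he, h⟩ => ⟨Finset.mem_univ v, ⟨he, hv⟩, h⟩⟩
    _ = 2 * cutWeight G w f := by
        rw [cutWeight, Finset.mul_sum]
        refine Finset.sum_congr rfl fun e he => ?_
        have h_edge := SimpleGraph.mem_edgeFinset.1 (Finset.mem_filter.1 he).1
        rw [Finset.sum_const, smul_eq_mul,
          Sym2.card_toFinset_of_not_isDiag e (G.not_isDiag_of_mem_edgeSet h_edge)]

theorem crossingWeight_add_crossingWeight_update (f : V → Bool) (v : V) :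
    crossingWeight G w f v + crossingWeight G w (Function.update f v (!f v)) v =
      weightedDegree G w v := by
  rw [weightedDegree, ← Finset.sum_filter_add_sum_filter_not _ fun u => f u ≠ f v]
  refine congrArg _ (Finset.sum_congr (Finset.filter_congr fun u hu => ?_) fun _ _ => rfl)
  have h_ne : u ≠ v := (G.mem_neighborFinset v u).1 hu |>.ne'
  rw [Function.update_self, Function.update_of_ne h_ne]
  cases f u <;> cases f v <;> decide

theorem cutWeight_add_crossingWeight_update (f : V → Bool) (v : V) (b : Bool) :
    cutWeight G w (Function.update f v b) + crossingWeight G w f v =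
      cutWeight G w f + crossingWeight G w (Function.update f v b) v := by
  have h_split (g : V → Bool) : cutWeight G w g = crossingWeight G w g v +
      ∑ e ∈ G.edgeFinset \ G.incidenceFinset v with (∃ a ∈ e, ∃ b ∈ e, g a ≠ g b), w e := by
    rw [crossingWeight_eq_sum_incidenceFinset, cutWeight, Finset.sum_filter, Finset.sum_filter,
      Finset.sum_filter, add_comm, Finset.sum_sdiff (G.incidenceFinset_subset v)]
  have h_rest : ∑ e ∈ G.edgeFinset \ G.incidenceFinset v with
      (∃ a ∈ e, ∃ c ∈ e, Function.update f v b a ≠ Function.update f v b c), w e =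
      ∑ e ∈ G.edgeFinset \ G.incidenceFinset v with (∃ a ∈ e, ∃ c ∈ e, f a ≠ f c), w e := by
    refine Finset.sum_congr (Finset.filter_congr fun e he => ?_) fun _ _ => rfl
    have h_ne : ∀ a ∈ e, a ≠ v := by
      rintro a ha rfl
      simp only [Finset.mem_sdiff, SimpleGraph.mem_edgeFinset,
        SimpleGraph.mem_incidenceFinset] at he
      exact he.2 ⟨he.1, ha⟩
    exact exists_congr fun a => and_congr_right fun ha => exists_congr fun c =>
      and_congr_right fun hc => by
        rw [Function.update_of_ne (h_ne a ha), Function.update_of_ne (h_ne c hc)]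
  rw [h_split, h_split f, h_rest]
  omega

variable (G w) in
omit [DecidableEq V] in
theorem exists_isStable : ∃ f, IsStable G w f := by
  classical
  obtain ⟨f, hf⟩ := Finite.exists_max (cutWeight G w)
  refine ⟨f, fun v => isStableAt_iff.2 ?_⟩
  have h_max := hf (Function.update f v (!f v))
  have h_cut := cutWeight_add_crossingWeight_update (G := G) (w := w) f v (!f v)
  have h_degree := crossingWeight_add_crossingWeight_update (G := G) (w := w) f v
  omega

variable (G w) in
theorem exists_isOptimal : ∃ f, IsOptimal G w f :=
  Set.exists_min_image {f | IsStable G w f} (cutWeight G w) (Set.toFinite _) (exists_isStable G w)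

theorem isOptimal_of_degree_le_one (hG : ∀ v, G.degree v ≤ 1) {f : V → Bool}
    (hf : ∀ u v, G.Adj u v → f u ≠ f v) : IsOptimal G w f := by
  have h_crossing (v : V) : crossingWeight G w f v = weightedDegree G w v := by
    rw [crossingWeight, weightedDegree, Finset.filter_true_of_mem]
    exact fun u hu => hf u v ((G.mem_neighborFinset v u).1 hu).symm
  refine ⟨fun v => isStableAt_iff.2 ?_, fun g hg => ?_⟩
  · rw [h_crossing]
    omega
  · have h_le (v : V) : weightedDegree G w v ≤ crossingWeight G w g v := by
      have h_stable := isStableAt_iff.1 (hg v)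
      rcases Finset.eq_empty_or_nonempty {u ∈ G.neighborFinset v | g u ≠ g v} with h | ⟨u, hu⟩
      · rw [crossingWeight, h, Finset.sum_empty] at h_stable
        omega
      · refine Finset.sum_le_sum_of_subset fun u' hu' => ?_
        rwa [Finset.card_le_one.1 (hG v) u' hu' u (Finset.mem_filter.1 hu).1]
    have h_sum := Finset.sum_le_sum fun v (_ : v ∈ Finset.univ) => (h_crossing v).trans_le (h_le v)
    rw [sum_crossingWeight, sum_crossingWeight] at h_sum
    omega

variable (G w)

/-- The vertices of `A` with a neighbor outside of `A`. -/
def boundary (A : Finset V) : Finset V := {v ∈ A | ∃ u, G.Adj v u ∧ u ∉ A}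

/-- The total weight of the edges between `v` and vertices of `A` that are cut. -/
def crossingWeightIn (A : Finset V) (f : V → Bool) (v : V) : ℕ :=
  ∑ u ∈ A with G.Adj v u ∧ f u ≠ f v, w s(v, u)

/-- The cut is stable for the vertices of `A` that have no neighbors outside of `A`. -/
def IsStableInside (A : Finset V) (f : V → Bool) : Prop :=
  ∀ v ∈ A \ boundary G A, weightedDegree G w v ≤ 2 * crossingWeightIn G w A f v

/-- The cuts `p` and `q` have the same restrictions to `A` as far as the rest of the graph is
concerned, so that these can be exchanged in every cut without an effect on its stability and its
weight. The sums are twice the weights inside `A`. -/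
structure Interchangeable (A : Finset V) (p q : V → Bool) : Prop where
  isStableInside_iff : IsStableInside G w A p ↔ IsStableInside G w A q
  sum_crossingWeightIn_eq :
    ∑ v ∈ A, crossingWeightIn G w A p v = ∑ v ∈ A, crossingWeightIn G w A q v
  eqOn : ∀ v ∈ boundary G A, p v = q v
  crossingWeightIn_eq : ∀ v ∈ boundary G A,
    crossingWeightIn G w A p v = crossingWeightIn G w A q v

variable {G w} {A B : Finset V} {p q f g : V → Bool} {v : V}

theorem mem_boundary : v ∈ boundary G A ↔ v ∈ A ∧ ∃ u, G.Adj v u ∧ u ∉ A := Finset.mem_filter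

theorem boundary_subset : boundary G A ⊆ A := Finset.filter_subset _ _

omit [Fintype V] [DecidableEq V] in
theorem crossingWeightIn_congr (h : ∀ u ∈ A, G.Adj v u → (f u ≠ f v ↔ g u ≠ g v)) :
    crossingWeightIn G w A f v = crossingWeightIn G w A g v :=
  Finset.sum_congr (Finset.filter_congr fun u hu => and_congr_right (h u hu)) fun _ _ => rfl

variable (A) in
theorem crossingWeightIn_add_crossingWeightIn_compl (f : V → Bool) (v : V) :
    crossingWeightIn G w A f v + crossingWeightIn G w Aᶜ f v = crossingWeight G w f v := by
  rw [crossingWeightIn, crossingWeightIn, Finset.sum_filter, Finset.sum_filter,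
    Finset.sum_add_sum_compl, ← Finset.sum_filter, crossingWeight,
    SimpleGraph.neighborFinset_eq_filter, Finset.filter_filter]

omit [DecidableEq V] in
theorem crossingWeightIn_le_weightedDegree : crossingWeightIn G w A f v ≤ weightedDegree G w v := by
  classical
  exact (Nat.le_add_right _ _).trans <|
    (crossingWeightIn_add_crossingWeightIn_compl A f v).trans_le
      (crossingWeight_le_weightedDegree f v)

omit [Fintype V] in
theorem crossingWeightIn_piecewise_of_mem (hv : v ∈ A) :
    crossingWeightIn G w A (A.piecewise p f) v = crossingWeightIn G w A p v :=
  crossingWeightIn_congr fun u hu _ => by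
    rw [A.piecewise_eq_of_mem _ _ hu, A.piecewise_eq_of_mem _ _ hv]

theorem crossingWeight_piecewise_of_mem_sdiff_boundary (hv : v ∈ A \ boundary G A) :
    crossingWeight G w (A.piecewise p f) v = crossingWeightIn G w A p v := by
  obtain ⟨h_mem, h_interior⟩ := Finset.mem_sdiff.1 hv
  have h_compl : crossingWeightIn G w Aᶜ (A.piecewise p f) v = 0 :=
    Finset.sum_eq_zero fun u hu => by
      obtain ⟨hu, h_adj, -⟩ := Finset.mem_filter.1 hu
      exact absurd (mem_boundary.2 ⟨h_mem, u, h_adj, Finset.mem_compl.1 hu⟩) h_interior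
  rw [← crossingWeightIn_add_crossingWeightIn_compl A, crossingWeightIn_piecewise_of_mem h_mem,
    h_compl, add_zero]

theorem Interchangeable.refl (A : Finset V) (p : V → Bool) :
    Interchangeable G w A p p :=
  ⟨Iff.rfl, rfl, fun _ _ => rfl, fun _ _ => rfl⟩

theorem Interchangeable.crossingWeightIn_compl (h : Interchangeable G w A p q) (f : V → Bool)
    (v : V) : crossingWeightIn G w Aᶜ (A.piecewise p f) v =
      crossingWeightIn G w Aᶜ (A.piecewise q f) v := by
  refine crossingWeightIn_congr fun u hu h_adj => ?_
  rw [Finset.mem_compl] at hu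
  have h_eq : A.piecewise p f v = A.piecewise q f v := by
    by_cases hv : v ∈ A
    · rw [A.piecewise_eq_of_mem _ _ hv, A.piecewise_eq_of_mem _ _ hv,
        h.eqOn v (mem_boundary.2 ⟨hv, u, h_adj, hu⟩)]
    · rw [A.piecewise_eq_of_notMem _ _ hv, A.piecewise_eq_of_notMem _ _ hv]
  rw [A.piecewise_eq_of_notMem _ _ hu, A.piecewise_eq_of_notMem _ _ hu, h_eq]

theorem Interchangeable.crossingWeightIn_of_notMem (h : Interchangeable G w A p q) (f : V → Bool)
    (hv : v ∉ A) : crossingWeightIn G w A (A.piecewise p f) v =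
      crossingWeightIn G w A (A.piecewise q f) v := by
  refine crossingWeightIn_congr fun u hu h_adj => ?_
  simp only [A.piecewise_eq_of_notMem _ _ hv, A.piecewise_eq_of_mem _ _ hu,
    h.eqOn u (mem_boundary.2 ⟨hu, v, h_adj.symm, hv⟩)]

theorem Interchangeable.crossingWeight_eq (h : Interchangeable G w A p q) (f : V → Bool)
    (hv : v ∉ A \ boundary G A) :
    crossingWeight G w (A.piecewise p f) v = crossingWeight G w (A.piecewise q f) v := by
  rw [← crossingWeightIn_add_crossingWeightIn_compl A, h.crossingWeightIn_compl,
    ← crossingWeightIn_add_crossingWeightIn_compl A]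
  by_cases h_mem : v ∈ A
  · have h_boundary : v ∈ boundary G A := by simpa [h_mem] using hv
    rw [crossingWeightIn_piecewise_of_mem h_mem, crossingWeightIn_piecewise_of_mem h_mem,
      h.crossingWeightIn_eq v h_boundary]
  · rw [h.crossingWeightIn_of_notMem f h_mem]

theorem Interchangeable.isStable_piecewise (h : Interchangeable G w A p q)
    (hq : IsStable G w (A.piecewise q f)) : IsStable G w (A.piecewise p f) := by
  intro v
  rw [isStableAt_iff]
  by_cases hv : v ∈ A \ boundary G A
  · have h_inside : IsStableInside G w A q := fun u hu =>
      crossingWeight_piecewise_of_mem_sdiff_boundary (f := f) hu ▸ isStableAt_iff.1 (hq u)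
    rw [crossingWeight_piecewise_of_mem_sdiff_boundary hv]
    exact h.isStableInside_iff.2 h_inside v hv
  · rw [h.crossingWeight_eq f hv]
    exact isStableAt_iff.1 (hq v)

theorem Interchangeable.cutWeight_piecewise (h : Interchangeable G w A p q) (f : V → Bool) :
    cutWeight G w (A.piecewise p f) = cutWeight G w (A.piecewise q f) := by
  refine Nat.eq_of_mul_eq_mul_left two_pos ?_
  have h_sum (r : V → Bool) : ∑ v, crossingWeight G w (A.piecewise r f) v =
      (∑ v ∈ A, crossingWeightIn G w A r v +
        ∑ v ∈ Aᶜ, crossingWeightIn G w A (A.piecewise r f) v) +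
        ∑ v, crossingWeightIn G w Aᶜ (A.piecewise r f) v := by
    rw [← Finset.sum_congr rfl fun v hv => crossingWeightIn_piecewise_of_mem (f := f) hv,
      Finset.sum_add_sum_compl, ← Finset.sum_add_distrib]
    exact Finset.sum_congr rfl fun v _ => (crossingWeightIn_add_crossingWeightIn_compl A _ v).symm
  rw [← sum_crossingWeight, ← sum_crossingWeight, h_sum, h_sum, h.sum_crossingWeightIn_eq,
    Finset.sum_congr rfl fun v hv => h.crossingWeightIn_of_notMem f (Finset.mem_compl.1 hv),
    Finset.sum_congr rfl fun v _ => h.crossingWeightIn_compl f v]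

theorem length_le_of_pairwise_not_interchangeable {D : ℕ} (hD : ∀ v, weightedDegree G w v ≤ D)
    {L : List (V → Bool)} (hL : L.Pairwise fun p q => ¬ Interchangeable G w A p q) :
    L.length ≤
      (2 * (D + 1)) ^ (boundary G A).card * (2 * (Fintype.card V * D + 1)) := by
  classical
  have h_crossing (p : V → Bool) (v : V) : crossingWeightIn G w A p v < D + 1 :=
    Nat.lt_succ_of_le (crossingWeightIn_le_weightedDegree.trans (hD v))
  have h_weight (p : V → Bool) : ∑ v ∈ A, crossingWeightIn G w A p v < Fintype.card V * D + 1 :=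
    Nat.lt_succ_of_le <|
      (Finset.sum_le_card_nsmul _ _ _ fun v _ => Nat.lt_succ_iff.1 (h_crossing p v)).trans
        (Nat.mul_le_mul_right _ (Finset.card_le_univ A))
  let signature (p : V → Bool) :
      (boundary G A → Bool × Fin (D + 1)) × Bool × Fin (Fintype.card V * D + 1) :=
    (fun v => (p v, ⟨_, h_crossing p v⟩), decide (IsStableInside G w A p), ⟨_, h_weight p⟩)
  have h_interchangeable (p q : V → Bool) (h : signature p = signature q) :
      Interchangeable G w A p q := by
    simp only [signature, Prod.mk.injEq, Fin.mk.injEq, funext_iff, Subtype.forall,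
      decide_eq_decide] at h
    exact ⟨h.2.1, h.2.2, fun v hv => (h.1 v hv).1, fun v hv => (h.1 v hv).2⟩
  have h_nodup : (L.map signature).Nodup :=
    List.pairwise_map.2 (hL.imp fun h h_eq => h (h_interchangeable _ _ h_eq))
  simpa using h_nodup.length_le_card

variable (G) in
theorem boundary_univ : boundary G Finset.univ = ∅ := by simp [boundary]

omit [DecidableEq V] in
theorem crossingWeightIn_univ (f : V → Bool) (v : V) :
    crossingWeightIn G w Finset.univ f v = crossingWeight G w f v := by
  rw [crossingWeightIn, crossingWeight, SimpleGraph.neighborFinset_eq_filter,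
    Finset.filter_filter]

theorem isStableInside_univ : IsStableInside G w Finset.univ f ↔ IsStable G w f := by
  simp only [IsStableInside, boundary_univ, Finset.sdiff_empty, Finset.mem_univ, forall_true_left,
    crossingWeightIn_univ, IsStable, isStableAt_iff]

variable (G w) in
/-- The restrictions to `A` of the cuts of `S` represent those of all stable cuts: every stable
cut can be changed on `A` into a cut of `S`, with the same weight, such that it stays stable. -/
def Represents (A : Finset V) (S : Set (V → Bool)) : Prop :=
  ∀ f, IsStable G w f → ∃ p ∈ S,
    IsStable G w (A.piecewise p f) ∧ cutWeight G w (A.piecewise p f) = cutWeight G w f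

variable {S S' : Set (V → Bool)}

theorem Represents.of_interchangeable (h : Represents G w A S)
    (hS : ∀ p ∈ S, ∃ q ∈ S', Interchangeable G w A q p) : Represents G w A S' := by
  intro f hf
  obtain ⟨p, hp, h_stable, h_weight⟩ := h f hf
  obtain ⟨q, hq, hqp⟩ := hS p hp
  exact ⟨q, hq, hqp.isStable_piecewise h_stable, (hqp.cutWeight_piecewise f).trans h_weight⟩

theorem Represents.union (hA : Represents G w A S) (hB : Represents G w B S') :
    Represents G w (A ∪ B) (Set.image2 (fun p q => A.piecewise p q) S S') := by
  intro f hf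
  obtain ⟨q, hq, hq_stable, hq_weight⟩ := hB f hf
  obtain ⟨p, hp, hp_stable, hp_weight⟩ := hA _ hq_stable
  refine ⟨A.piecewise p q, Set.mem_image2_of_mem hp hq, ?_⟩
  have h_piecewise : (A ∪ B).piecewise (A.piecewise p q) f =
      A.piecewise p (B.piecewise q f) := by
    funext v
    by_cases hvA : v ∈ A <;> by_cases hvB : v ∈ B <;> simp [Finset.piecewise, hvA, hvB]
  rw [h_piecewise]
  exact ⟨hp_stable, hp_weight.trans hq_weight⟩

theorem represents_empty (hS : S.Nonempty) : Represents G w ∅ S := fun f hf => by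
  obtain ⟨p, hp⟩ := hS
  refine ⟨p, hp, ?_⟩
  rw [Finset.piecewise_empty]
  exact ⟨hf, rfl⟩

theorem represents_singleton (v : V) :
    Represents G w {v} {fun _ => false, fun _ => true} := by
  intro f hf
  refine ⟨fun _ => f v, by cases f v <;> simp, ?_⟩
  have h_piecewise : ({v} : Finset V).piecewise (fun _ => f v) f = f := by
    rw [Finset.piecewise_singleton, Function.update_eq_self]
  rw [h_piecewise]
  exact ⟨hf, rfl⟩

theorem Represents.exists_isStable_cutWeight_eq (h : Represents G w Finset.univ S) {f : V → Bool}
    (hf : IsStable G w f) : ∃ p ∈ S, IsStable G w p ∧ cutWeight G w p = cutWeight G w f := by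
  simpa only [Finset.piecewise_univ] using h f hf

end Cuts

/-! ### Contractions of tree decompositions -/

section Grouping

variable {V ι : Type*} {G : SimpleGraph V} {D : TreeDecomposition G ι} {T : SimpleGraph ι}
  {grp : ι → ι}

/-- A partition of the nodes of a tree into groups that are represented by one of their nodes,
such that only representatives are adjacent to nodes of other groups. It describes a tree in which
some leaves have been contracted, one after the other, into their neighbors. -/
structure IsGrouping (T : SimpleGraph ι) (grp : ι → ι) : Prop where
  idem : ∀ r, grp (grp r) = grp r
  eq_of_adj : ∀ r s, T.Adj r s → grp r ≠ grp s → grp r = r ∧ grp s = s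

theorem isGrouping_id (T : SimpleGraph ι) : IsGrouping T id :=
  ⟨fun _ => rfl, fun _ _ _ _ => ⟨rfl, rfl⟩⟩

theorem IsGrouping.contract [DecidableEq ι] (h : IsGrouping T grp) {t s : ι} (hts : T.Adj t s)
    (hs : grp s = s) (h_leaf : ∀ r, T.Adj t r → grp r = r → r = s) :
    IsGrouping T fun r => if grp r = t then s else grp r := by
  have hst : s ≠ t := hts.ne'
  refine ⟨fun r => ?_, fun r q hrq h_ne => ?_⟩
  · by_cases hr : grp r = t
    · simp [hr, hs, hst]
    · simp [hr, h.idem]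
  · have h_grp : grp r ≠ grp q := fun h_eq => h_ne (by rw [h_eq])
    obtain ⟨hr, hq⟩ := h.eq_of_adj r q hrq h_grp
    rw [hr, hq] at h_ne ⊢
    rcases eq_or_ne r t with rfl | hrt
    · exact absurd (h_leaf q hrq hq) fun hqs => h_ne (by simp [hqs, hst])
    rcases eq_or_ne q t with rfl | hqt
    · exact absurd (h_leaf r hrq.symm hr) fun hrs => h_ne (by simp [hrs, hst])
    · simp [hrt, hqt]

theorem IsGrouping.reachable_induce (h : IsGrouping T grp) {a b : ι} (hab : T.Reachable a b) :
    (T.induce {t | grp t = t}).Reachable ⟨grp a, h.idem a⟩ ⟨grp b, h.idem b⟩ := by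
  obtain ⟨walk⟩ := hab
  induction walk with
  | nil => rfl
  | @cons a c b hac _ ih =>
    by_cases hc : grp a = grp c
    · simpa only [hc] using ih
    · obtain ⟨h_a, h_c⟩ := h.eq_of_adj a c hac hc
      have h_adj : (T.induce {t | grp t = t}).Adj ⟨grp a, h.idem a⟩ ⟨grp c, h.idem c⟩ := by
        change T.Adj (grp a) (grp c)
        rwa [h_a, h_c]
      exact h_adj.reachable.trans ih

theorem IsGrouping.isTree_induce (h : IsGrouping T grp) (hT : T.IsTree) :
    (T.induce {t | grp t = t}).IsTree := by
  obtain ⟨r⟩ := hT.connected.nonempty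
  have : Nonempty {t | grp t = t} := ⟨⟨grp r, h.idem r⟩⟩
  refine ⟨⟨fun x y => ?_⟩, hT.isAcyclic.induce _⟩
  have h_reachable := h.reachable_induce (hT.connected.preconnected x.1 y.1)
  simpa only [show grp x.1 = x.1 from x.2, show grp y.1 = y.1 from y.2] using h_reachable

theorem IsGrouping.exists_leaf [Finite ι] (h : IsGrouping T grp) (hT : T.IsTree) {a b : ι}
    (hab : grp a ≠ grp b) :
    ∃ t s, grp t = t ∧ grp s = s ∧ T.Adj t s ∧ ∀ r, T.Adj t r → grp r = r → r = s := by
  classical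
  have := Fintype.ofFinite ι
  have : Nontrivial {t | grp t = t} :=
    ⟨⟨⟨grp a, h.idem a⟩, ⟨grp b, h.idem b⟩, fun he => hab (congrArg Subtype.val he)⟩⟩
  obtain ⟨t, ht⟩ := (h.isTree_induce hT).exists_vert_degree_one_of_nontrivial
  obtain ⟨s, hs, h_unique⟩ := SimpleGraph.degree_eq_one_iff_existsUnique_adj.1 ht
  exact ⟨t, s, t.2, s.2, hs, fun r hr hr' => congrArg Subtype.val (h_unique ⟨r, hr'⟩ hr)⟩

theorem IsGrouping.mem_bag_of_reachable (h : IsGrouping D.tree grp) {v : V}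
    {a b : {t | v ∈ D.bag t}} (hab : (D.tree.induce {t | v ∈ D.bag t}).Reachable a b)
    (h_ne : grp a ≠ grp b) : v ∈ D.bag (grp a) := by
  obtain ⟨walk⟩ := hab
  induction walk with
  | nil => exact absurd rfl h_ne
  | @cons a c b hac _ ih =>
    by_cases hc : grp c = grp a
    · exact hc ▸ ih (hc ▸ h_ne)
    · rw [(h.eq_of_adj a c hac (Ne.symm hc)).1]
      exact a.2

theorem IsGrouping.mem_bag_grp (h : IsGrouping D.tree grp) {v u : V} {r : ι} (hv : v ∈ D.bag r)
    (hvu : G.Adj v u) (hu : ∀ s, grp s = grp r → u ∉ D.bag s) : v ∈ D.bag (grp r) := by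
  obtain ⟨s, hvs, hus⟩ := D.exists_edge_bag v u hvu
  exact h.mem_bag_of_reachable ((D.connected v).preconnected ⟨r, hv⟩ ⟨s, hvs⟩)
    fun h_eq => hu s h_eq.symm hus

theorem TreeDecomposition.card_bag_le [Fintype ι] (D : TreeDecomposition G ι) (t : ι) :
    (D.bag t).card ≤ D.width + 1 := by
  have h_sup := Finset.le_sup (f := fun t => (D.bag t).card) (Finset.mem_univ t)
  rw [TreeDecomposition.width]
  omega

variable [Fintype ι] [DecidableEq ι] [DecidableEq V]

/-- The union of the bags of the nodes of the group of `t`. -/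
def groupSet (D : TreeDecomposition G ι) (grp : ι → ι) (t : ι) :
    Finset V :=
  ({r | grp r = t} : Finset ι).biUnion D.bag

theorem mem_groupSet {t : ι} {v : V} :
    v ∈ groupSet D grp t ↔ ∃ r, grp r = t ∧ v ∈ D.bag r := by
  simp [groupSet]

theorem IsGrouping.boundary_groupSet_subset [Fintype V] [DecidableRel G.Adj]
    (h : IsGrouping D.tree grp) (t : ι) :
    boundary G (groupSet D grp t) ⊆ D.bag t := by
  intro v hv
  obtain ⟨hv, u, hvu, hu⟩ := mem_boundary.1 hv
  obtain ⟨r, rfl, hvr⟩ := mem_groupSet.1 hv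
  exact h.mem_bag_grp hvr hvu fun s hs hus => hu (mem_groupSet.2 ⟨s, hs, hus⟩)

theorem groupSet_contract {t s : ι} (hts : t ≠ s) {r : ι} (hr : r ≠ t) :
    groupSet D (fun q => if grp q = t then s else grp q) r =
      if r = s then groupSet D grp t ∪ groupSet D grp r else groupSet D grp r := by
  ext v
  split_ifs with hrs
  · simp only [mem_groupSet, Finset.mem_union]
    grind
  · simp only [mem_groupSet]
    grind

end Grouping

/-! ### Lists and the objects they encode -/

section Lists

variable {n : ℕ}

theorem countP_range_eq (n : ℕ) (P : ℕ → Bool) :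
    (List.range n).countP P = ({u : Fin n | P u = true} : Finset (Fin n)).card := by
  rw [← List.map_coe_finRange_eq_range, List.countP_map, List.countP_eq_length_filter,
    ← List.toFinset_card_of_nodup ((List.nodup_finRange n).filter _)]
  congr 1
  ext u
  simp

theorem all_range_iff {P : ℕ → Bool} :
    (List.range n).all P = true ↔ ∀ u : Fin n, P u = true := by
  simp [Fin.forall_iff]

theorem any_range_iff {P : ℕ → Bool} :
    (List.range n).any P = true ↔ ∃ u : Fin n, P u = true := by
  simp [Fin.exists_iff]

theorem sum_map_filter_range (n : ℕ) (P : ℕ → Bool) (f : ℕ → ℕ) :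
    (((List.range n).filter P).map f).sum =
      ∑ u ∈ ({u : Fin n | P u = true} : Finset (Fin n)), f u := by
  rw [Finset.sum_filter, ← Finset.sum_range fun u => if P u = true then f u else 0]
  induction n with
  | zero => rfl
  | succ n ih => cases h : P n <;> simp [List.range_succ, Finset.sum_range_succ, ih, h]

theorem bit_map_range (f : ℕ → Bool) (v : Fin n) : bit ((List.range n).map f) v = f v := by
  simp [bit]

/-- The cut given by the list of the sides of the vertices. -/
def cutOf (n : ℕ) (p : List Bool) (v : Fin n) : Bool := bit p v

/-- The set of vertices given by its characteristic vector. -/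
def vertexSet (n : ℕ) (A : List Bool) : Finset (Fin n) := {v | bit A v = true}

theorem mem_vertexSet {A : List Bool} {v : Fin n} : v ∈ vertexSet n A ↔ bit A v = true := by
  simp [vertexSet]

theorem ofFn_cutOf {p : List Bool} (hp : p.length = n) : List.ofFn (cutOf n p) = p :=
  List.ext_getElem (by simp [hp]) fun i _ hi => by simp [cutOf, bit, hi]

/-- The list of the rows of a matrix. -/
def matrixList {m n : ℕ} (f : Fin m → Fin n → Bool) : List (List Bool) :=
  List.ofFn fun i => List.ofFn (f i)

theorem length_matrixList {m : ℕ} (f : Fin m → Fin n → Bool) : (matrixList f).length = m :=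
  List.length_ofFn

theorem entry_matrixList {m : ℕ} (f : Fin m → Fin n → Bool) (i : Fin m) (j : Fin n) :
    entry (matrixList f) i j = f i j := by
  simp [entry, bit, matrixList]

/-- The list of the rows of the adjacency matrix. -/
def adjList (G : SimpleGraph (Fin n)) [DecidableRel G.Adj] : List (List Bool) :=
  matrixList fun u v => decide (G.Adj u v)

theorem entry_adjList {G : SimpleGraph (Fin n)} [DecidableRel G.Adj] {u v : Fin n} :
    entry (adjList G) u v = decide (G.Adj u v) :=
  entry_matrixList _ u v

end Lists

section Cuts

variable {n : ℕ} {G : SimpleGraph (Fin n)} [DecidableRel G.Adj] {A B p q : List Bool}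

variable (G) in
theorem length_adjList : (adjList G).length = n := length_matrixList _

theorem weightedDegree_one (v : Fin n) : weightedDegree G (fun _ => 1) v = G.degree v := by
  rw [weightedDegree, Finset.sum_const, smul_eq_mul, mul_one,
    SimpleGraph.card_neighborFinset_eq_degree]

theorem degreeAt_adjList (v : Fin n) : degreeAt (adjList G) v = G.degree v := by
  rw [degreeAt, length_adjList, countP_range_eq, ← SimpleGraph.card_neighborFinset_eq_degree]
  simp only [entry_adjList, decide_eq_true_eq, SimpleGraph.neighborFinset_eq_filter]

theorem crossingsAt_adjList (v : Fin n) : crossingsAt (adjList G) A p v =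
    crossingWeightIn G (fun _ => 1) (vertexSet n A) (cutOf n p) v := by
  rw [crossingsAt, length_adjList, countP_range_eq, crossingWeightIn, ← Finset.card_eq_sum_ones]
  congr 1
  ext u
  rw [Finset.mem_filter_univ, Finset.mem_filter, mem_vertexSet, entry_adjList]
  simp [cutOf]

theorem isBoundary_adjList {v : Fin n} :
    isBoundary (adjList G) A v = true ↔ v ∈ boundary G (vertexSet n A) := by
  rw [isBoundary, Bool.and_eq_true, length_adjList, any_range_iff, mem_boundary, mem_vertexSet]
  simp only [Bool.and_eq_true, entry_adjList, decide_eq_true_eq, Bool.not_eq_true',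
    mem_vertexSet, Bool.not_eq_true]

theorem stableInside_adjList : stableInside (adjList G) A p = true ↔
    IsStableInside G (fun _ => 1) (vertexSet n A) (cutOf n p) := by
  rw [stableInside, length_adjList, all_range_iff]
  refine forall_congr' fun v => ?_
  rw [Bool.or_eq_true, Bool.or_eq_true, isBoundary_adjList, degreeAt_adjList, crossingsAt_adjList,
    Nat.ble_eq, weightedDegree_one, two_mul, Finset.mem_sdiff, mem_vertexSet, Bool.not_eq_true']
  cases bit A v <;> simp [or_iff_not_imp_left]

theorem weightInside_adjList : weightInside (adjList G) A p =
    ∑ v ∈ vertexSet n A, crossingWeightIn G (fun _ => 1) (vertexSet n A) (cutOf n p) v := by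
  simp only [weightInside, length_adjList, sum_map_filter_range, crossingsAt_adjList, vertexSet]

theorem interchangeable_adjList : interchangeable (adjList G) A p q = true ↔
    Interchangeable G (fun _ => 1) (vertexSet n A) (cutOf n p) (cutOf n q) := by
  have h_stable : (!(stableInside (adjList G) A p ^^ stableInside (adjList G) A q)) = true ↔
      (IsStableInside G (fun _ => 1) (vertexSet n A) (cutOf n p) ↔
        IsStableInside G (fun _ => 1) (vertexSet n A) (cutOf n q)) := by
    rw [← stableInside_adjList, ← stableInside_adjList]
    cases stableInside (adjList G) A p <;> cases stableInside (adjList G) A q <;> decide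
  have h_boundary (v : Fin n) : (!isBoundary (adjList G) A v || (!(bit p v ^^ bit q v) &&
      (crossingsAt (adjList G) A p v).beq (crossingsAt (adjList G) A q v))) = true ↔
      (v ∈ boundary G (vertexSet n A) → cutOf n p v = cutOf n q v ∧
        crossingWeightIn G (fun _ => 1) (vertexSet n A) (cutOf n p) v =
          crossingWeightIn G (fun _ => 1) (vertexSet n A) (cutOf n q) v) := by
    rw [Bool.or_eq_true, Bool.and_eq_true, Nat.beq_eq, crossingsAt_adjList, crossingsAt_adjList,
      ← isBoundary_adjList]
    cases isBoundary (adjList G) A v <;> simp [cutOf]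
  rw [interchangeable, Bool.and_eq_true, Bool.and_eq_true, h_stable, Nat.beq_eq,
    weightInside_adjList, weightInside_adjList, length_adjList, all_range_iff,
    forall_congr' h_boundary]
  exact ⟨fun ⟨h_inside, h_weight, h⟩ =>
      ⟨h_inside, h_weight, fun v hv => (h v hv).1, fun v hv => (h v hv).2⟩,
    fun h => ⟨h.1, h.2, fun v hv => ⟨h.3 v hv, h.4 v hv⟩⟩⟩

theorem vertexSet_constList_false : vertexSet n (constList (adjList G) false) = ∅ := by
  ext v
  rw [mem_vertexSet, constList, length_adjList, bit_map_range]
  simp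

theorem vertexSet_singletonTable (v : Fin n) :
    vertexSet n (singletonTable (adjList G) v).vertices = {v} := by
  ext u
  simp [mem_vertexSet, singletonTable, length_adjList, bit_map_range, Fin.ext_iff]

theorem vertexSet_union : vertexSet n (union (adjList G) A B) = vertexSet n A ∪ vertexSet n B := by
  ext v
  simp [mem_vertexSet, union, length_adjList, bit_map_range]

theorem cutOf_constList (b : Bool) : cutOf n (constList (adjList G) b) = fun _ => b := by
  funext v
  simp only [cutOf, constList, length_adjList, bit_map_range]

theorem cutOf_override : cutOf n (override (adjList G) A p q) =
    (vertexSet n A).piecewise (cutOf n p) (cutOf n q) := by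
  funext v
  rw [cutOf, override, length_adjList, bit_map_range, Finset.piecewise]
  cases hv : bit A v <;> simp [mem_vertexSet, hv, cutOf]

theorem length_constList (b : Bool) : (constList (adjList G) b).length = n := by
  simp [constList, length_adjList]

theorem length_union : (union (adjList G) A B).length = n := by simp [union, length_adjList]

theorem length_override : (override (adjList G) A p q).length = n := by
  simp [override, length_adjList]

variable {L : List (List Bool)}

theorem mem_of_mem_prune {M : List (List Bool)} (hp : p ∈ prune M A L) : p ∈ L :=
  (reverse_prune_sublist M A L).subset (List.mem_reverse.2 hp)

theorem exists_mem_prune (G : SimpleGraph (Fin n)) [DecidableRel G.Adj] (A : List Bool)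
    (L : List (List Bool)) : ∀ p ∈ L, ∃ q ∈ prune (adjList G) A L,
      Interchangeable G (fun _ => 1) (vertexSet n A) (cutOf n q) (cutOf n p) := by
  induction L using List.reverseRecOn with
  | nil => simp
  | append_singleton L p ih =>
    rw [prune_append_singleton]
    cases h : (prune (adjList G) A L).any fun q => interchangeable (adjList G) A q p with
    | true =>
      refine List.forall_mem_append.2 ⟨ih, List.forall_mem_singleton.2 ?_⟩
      obtain ⟨q, hq, hqp⟩ := List.any_eq_true.1 h
      exact ⟨q, hq, interchangeable_adjList.1 hqp⟩
    | false =>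
      refine List.forall_mem_append.2 ⟨fun r hr => ?_, List.forall_mem_singleton.2 ?_⟩
      · obtain ⟨q, hq, hqr⟩ := ih r hr
        exact ⟨q, List.mem_cons_of_mem _ hq, hqr⟩
      · exact ⟨p, List.mem_cons_self, .refl _ _⟩

theorem pairwise_not_interchangeable_prune (G : SimpleGraph (Fin n)) [DecidableRel G.Adj]
    (A : List Bool) (L : List (List Bool)) : (prune (adjList G) A L).Pairwise fun p q =>
      ¬ Interchangeable G (fun _ => 1) (vertexSet n A) (cutOf n q) (cutOf n p) := by
  induction L using List.reverseRecOn with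
  | nil => simp [prune]
  | append_singleton L p ih =>
    rw [prune_append_singleton]
    cases h : (prune (adjList G) A L).any fun q => interchangeable (adjList G) A q p with
    | true => exact ih
    | false =>
      refine List.pairwise_cons.2 ⟨fun q hq hqp => ?_, ih⟩
      exact Bool.false_ne_true (h.symm.trans <|
        List.any_eq_true.2 ⟨q, hq, interchangeable_adjList.2 hqp⟩)

theorem length_prune_le (G : SimpleGraph (Fin n)) [DecidableRel G.Adj] (A : List Bool)
    (L : List (List Bool)) : (prune (adjList G) A L).length ≤
      (2 * (G.maxDegree + 1)) ^ (boundary G (vertexSet n A)).card *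
        (2 * (n * G.maxDegree + 1)) := by
  have h_pairwise : ((prune (adjList G) A L).reverse.map (cutOf n)).Pairwise fun p q =>
      ¬ Interchangeable G (fun _ => 1) (vertexSet n A) p q :=
    List.pairwise_map.2 (List.pairwise_reverse.2 (pairwise_not_interchangeable_prune G A L))
  simpa using length_le_of_pairwise_not_interchangeable
    (fun v => (weightedDegree_one v).trans_le (G.degree_le_maxDegree v)) h_pairwise

theorem isMatching_adjList : isMatching (adjList G) = true ↔ ∀ v, G.degree v ≤ 1 := by
  simp only [isMatching, length_adjList, all_range_iff, degreeAt_adjList, Nat.ble_eq]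

theorem isUnweightedOptimal_matchingCut (hG : ∀ v, G.degree v ≤ 1) :
    IsUnweightedOptimal G (cutOf n (matchingCut (adjList G))) := by
  refine isOptimal_of_degree_le_one hG fun u v huv => ?_
  have h_side {a b : Fin n} (hab : G.Adj a b) :
      cutOf n (matchingCut (adjList G)) a = decide (b < a) := by
    have h_unique (x : Fin n) (hx : G.Adj a x) : x = b :=
      Finset.card_le_one.1 (hG a) x ((G.mem_neighborFinset a x).2 hx) b
        ((G.mem_neighborFinset a b).2 hab)
    rw [Bool.eq_iff_iff, cutOf, matchingCut, length_adjList, bit_map_range, any_range_iff]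
    simp only [Bool.and_eq_true, entry_adjList, decide_eq_true_eq, Bool.not_eq_true',
      ← Bool.not_eq_true, Nat.ble_eq, not_le, Fin.val_fin_lt]
    exact ⟨fun ⟨x, hx, h_adj⟩ => h_unique x h_adj ▸ hx, fun h => ⟨b, h, hab⟩⟩
  rw [h_side huv, h_side huv.symm, ne_eq, decide_eq_decide]
  have := huv.ne
  omega

theorem length_matchingCut : (matchingCut (adjList G)).length = n := by
  simp [matchingCut, length_adjList]

end Cuts

/-! ### The tables of the dynamic program -/

section Tables

variable {n : ℕ} {G : SimpleGraph (Fin n)} [DecidableRel G.Adj] {b : ℕ} {A B : Finset (Fin n)}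
  {x y : Table}

/-- A bound for the number of the cuts of a table whose set of vertices has a boundary of at most
`b` vertices. -/
def tableBound (G : SimpleGraph (Fin n)) [DecidableRel G.Adj] (b : ℕ) : ℕ :=
  (2 * (G.maxDegree + 1)) ^ b * (2 * (n * G.maxDegree + 1))

theorem two_le_tableBound (G : SimpleGraph (Fin n)) [DecidableRel G.Adj] (b : ℕ) :
    2 ≤ tableBound G b :=
  Nat.le_mul_of_pos_left 2 (by positivity) |>.trans <| Nat.mul_le_mul_left _ (by omega)

/-- The table `x` has the set of vertices `A`, and its cuts represent all stable cuts on `A`;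
there are at most `tableBound G b` of them. -/
structure Table.IsValid (G : SimpleGraph (Fin n)) [DecidableRel G.Adj] (b : ℕ)
    (A : Finset (Fin n)) (x : Table) : Prop where
  length_vertices : x.vertices.length = n
  vertexSet_eq : vertexSet n x.vertices = A
  length_cut : ∀ p ∈ x.cuts, p.length = n
  length_cuts_le : x.cuts.length ≤ tableBound G b
  represents : Represents G (fun _ => 1) A (cutOf n '' {p | p ∈ x.cuts})

theorem isValid_empty (t : ℕ) : Table.IsValid G b ∅
    ⟨t, constList (adjList G) false, [constList (adjList G) false]⟩ where
  length_vertices := length_constList false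
  vertexSet_eq := vertexSet_constList_false
  length_cut := by simp [length_constList]
  length_cuts_le := one_le_two.trans (two_le_tableBound G b)
  represents := represents_empty (by simp)

theorem isValid_singletonTable (v : Fin n) :
    (singletonTable (adjList G) v).IsValid G b {v} where
  length_vertices := by simp [singletonTable, length_adjList]
  vertexSet_eq := vertexSet_singletonTable v
  length_cut := by simp [singletonTable, length_constList]
  length_cuts_le := two_le_tableBound G b
  represents := by
    refine (represents_singleton v).of_interchangeable fun p hp => ⟨p, ?_, .refl _ _⟩
    rcases hp with rfl | rfl
    · exact ⟨constList (adjList G) false, by simp [singletonTable], cutOf_constList false⟩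
    · exact ⟨constList (adjList G) true, by simp [singletonTable], cutOf_constList true⟩

theorem Table.IsValid.merge (hx : x.IsValid G b A) (hy : y.IsValid G b B)
    (h_boundary : (boundary G (A ∪ B)).card ≤ b) :
    (x.merge (adjList G) y).IsValid G b (A ∪ B) := by
  have h_vertexSet : vertexSet n (union (adjList G) x.vertices y.vertices) = A ∪ B := by
    rw [vertexSet_union, hx.vertexSet_eq, hy.vertexSet_eq]
  refine ⟨length_union, h_vertexSet, fun r hr => ?_, ?_, ?_⟩
  · obtain ⟨p, -, hr⟩ := List.mem_flatMap.1 (mem_of_mem_prune hr)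
    obtain ⟨q, -, rfl⟩ := List.mem_map.1 hr
    exact length_override
  · refine (length_prune_le G _ _).trans (Nat.mul_le_mul_right _ ?_)
    exact Nat.pow_le_pow_right (by omega) (h_vertexSet ▸ h_boundary)
  · refine (hx.represents.union hy.represents).of_interchangeable ?_
    rintro _ ⟨_, ⟨p, hp, rfl⟩, _, ⟨q, hq, rfl⟩, rfl⟩
    have h_mem : override (adjList G) x.vertices p q ∈
        x.cuts.flatMap fun p => y.cuts.map fun q => override (adjList G) x.vertices p q :=
      List.mem_flatMap.2 ⟨p, hp, List.mem_map.2 ⟨q, hq, rfl⟩⟩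
    obtain ⟨r, hr, h_interchangeable⟩ := exists_mem_prune G
      (union (adjList G) x.vertices y.vertices) _ _ h_mem
    rw [h_vertexSet, cutOf_override, hx.vertexSet_eq] at h_interchangeable
    exact ⟨_, ⟨r, hr, rfl⟩, h_interchangeable⟩

section Best

variable {p : List Bool}

theorem Table.IsValid.mem_bestCuts_iff (hx : x.IsValid G b Finset.univ) :
    p ∈ bestCuts (adjList G) x ↔ p ∈ x.cuts ∧ IsUnweightedOptimal G (cutOf n p) := by
  have h_stable (q : List Bool) : stableInside (adjList G) x.vertices q = true ↔
      IsStable G (fun _ => 1) (cutOf n q) := by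
    rw [stableInside_adjList, hx.vertexSet_eq, isStableInside_univ]
  have h_weight (q : List Bool) : weightInside (adjList G) x.vertices q =
      2 * cutWeight G (fun _ => 1) (cutOf n q) := by
    rw [weightInside_adjList, hx.vertexSet_eq, ← sum_crossingWeight]
    simp only [crossingWeightIn_univ]
  rw [bestCuts, List.mem_filter, Bool.and_eq_true, h_stable, List.all_eq_true]
  refine and_congr_right fun _ => and_congr_right fun _ => ⟨fun h g hg => ?_, fun h q _ => ?_⟩
  · obtain ⟨_, ⟨q, hq, rfl⟩, hq_stable, hq_weight⟩ := hx.represents.exists_isStable_cutWeight_eq hg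
    have h_le := h q hq
    rw [(h_stable q).2 hq_stable, Bool.not_true, Bool.false_or, Nat.ble_eq, h_weight,
      h_weight] at h_le
    omega
  · rw [Bool.or_eq_true, Bool.not_eq_true', ← Bool.not_eq_true, h_stable, Nat.ble_eq, h_weight,
      h_weight]
    exact or_iff_not_imp_left.2 fun hq => Nat.mul_le_mul_left 2 (h _ (not_not.1 hq))

theorem Table.IsValid.bestCuts_ne_nil (hx : x.IsValid G b Finset.univ) :
    bestCuts (adjList G) x ≠ [] := by
  obtain ⟨f, hf, h_min⟩ := exists_isOptimal G fun _ => 1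
  obtain ⟨_, ⟨p, hp, rfl⟩, hp_stable, hp_weight⟩ := hx.represents.exists_isStable_cutWeight_eq hf
  exact List.ne_nil_of_mem (hx.mem_bestCuts_iff.2
    ⟨hp, hp_stable, fun g hg => hp_weight.trans_le (h_min g hg)⟩)

end Best

end Tables

section Tabulates

variable {n N b : ℕ} {G : SimpleGraph (Fin n)} [DecidableRel G.Adj] {R : Finset (Fin N)}
  {S S' : Fin N → Finset (Fin n)} {l : List Table}

/-- The list consists of one valid table for the set of vertices `S t` for each node `t` of
`R`. -/
structure Tabulates (G : SimpleGraph (Fin n)) [DecidableRel G.Adj] (b : ℕ) (R : Finset (Fin N))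
    (S : Fin N → Finset (Fin n)) (l : List Table) : Prop where
  nodup : (l.map Table.node).Nodup
  exists_isValid : ∀ x ∈ l, ∃ t ∈ R, x.node = t ∧ x.IsValid G b (S t)
  exists_table : ∀ t ∈ R, ∃ x ∈ l, x.node = t

theorem Tabulates.isValid (h : Tabulates G b R S l) {x : Table} {t : Fin N} (hx : x ∈ l)
    (hxt : x.node = t) : t ∈ R ∧ x.IsValid G b (S t) := by
  obtain ⟨s, hs, hxs, h_valid⟩ := h.exists_isValid x hx
  obtain rfl : s = t := Fin.ext (hxs.symm.trans hxt)
  exact ⟨hs, h_valid⟩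

theorem Tabulates.length_eq (h : Tabulates G b R S l) : l.length = R.card := by
  have h_nodes : (l.map Table.node).toFinset = R.map Fin.valEmbedding := by
    ext t
    simp only [List.mem_toFinset, List.mem_map, Finset.mem_map, Fin.valEmbedding_apply]
    constructor
    · rintro ⟨x, hx, rfl⟩
      obtain ⟨t, ht, hxt, -⟩ := h.exists_isValid x hx
      exact ⟨t, ht, hxt.symm⟩
    · rintro ⟨t, ht, rfl⟩
      exact h.exists_table t ht
  rw [← Finset.card_map, ← h_nodes, List.toFinset_card_of_nodup h.nodup, List.length_map]

theorem Tabulates.map (h : Tabulates G b R S l) {f : Table → Table}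
    (hf_node : ∀ x, (f x).node = x.node)
    (hf : ∀ t ∈ R, ∀ x : Table, x.node = t → x.IsValid G b (S t) → (f x).IsValid G b (S' t)) :
    Tabulates G b R S' (l.map f) where
  nodup := by simpa [Function.comp_def, hf_node] using h.nodup
  exists_isValid := by
    refine List.forall_mem_map.2 fun x hx => ?_
    obtain ⟨t, ht, hxt, h_valid⟩ := h.exists_isValid x hx
    exact ⟨t, ht, (hf_node x).trans hxt, hf t ht x hxt h_valid⟩
  exists_table t ht := by
    obtain ⟨x, hx, hxt⟩ := h.exists_table t ht
    exact ⟨f x, List.mem_map_of_mem hx, (hf_node x).trans hxt⟩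

theorem Tabulates.erase (h : Tabulates G b R S l) (s : Fin N) :
    Tabulates G b (R.erase s) S (l.filter fun z => !z.node.beq s) where
  nodup := h.nodup.sublist (List.filter_sublist.map _)
  exists_isValid x hx := by
    obtain ⟨hx, hxs⟩ := List.mem_filter.1 hx
    obtain ⟨t, ht, hxt, h_valid⟩ := h.exists_isValid x hx
    refine ⟨t, Finset.mem_erase.2 ⟨?_, ht⟩, hxt, h_valid⟩
    rintro rfl
    simp [hxt] at hxs
  exists_table t ht := by
    obtain ⟨hts, ht⟩ := Finset.mem_erase.1 ht
    obtain ⟨x, hx, hxt⟩ := h.exists_table t ht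
    refine ⟨x, List.mem_filter.2 ⟨hx, ?_⟩, hxt⟩
    simpa [hxt, Fin.val_inj, ← Bool.not_eq_true] using hts

end Tabulates

/-! ### Correctness of the dynamic program -/

section Correctness

variable {n N : ℕ} {G : SimpleGraph (Fin n)} {D : TreeDecomposition G (Fin N)}

/-- The vertices less than `k` in the bag of `t`. -/
def partialBag (D : TreeDecomposition G (Fin N)) (k : ℕ) (t : Fin N) : Finset (Fin n) :=
  {v ∈ D.bag t | v < k}

theorem partialBag_succ (v : Fin n) (t : Fin N) :
    partialBag D (v + 1) t = if v ∈ D.bag t then {v} ∪ partialBag D v t else partialBag D v t := by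
  ext u
  split_ifs <;>
  · simp only [partialBag, Finset.mem_filter, Finset.mem_union, Finset.mem_singleton,
      Nat.lt_succ_iff_lt_or_eq, Fin.val_inj]
    grind

variable [DecidableRel G.Adj] {l : List Table}

theorem card_boundary_le {A : Finset (Fin n)} {t : Fin N} (h : boundary G A ⊆ D.bag t) :
    (boundary G A).card ≤ D.width + 1 :=
  (Finset.card_le_card h).trans (D.card_bag_le t)

theorem Tabulates.introduce {v : Fin n}
    (h : Tabulates G (D.width + 1) Finset.univ (partialBag D v) l) :
    Tabulates G (D.width + 1) Finset.univ (partialBag D (v + 1))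
      (introduce (adjList G) (matrixList fun t v => decide (v ∈ D.bag t)) l v) := by
  refine h.map (fun x => ?_) fun t _ x hxt hx => ?_
  · cases entry _ x.node v <;> rfl
  · have h_boundary : boundary G (partialBag D (v + 1) t) ⊆ D.bag t :=
      boundary_subset.trans (Finset.filter_subset _ _)
    rw [partialBag_succ] at h_boundary ⊢
    rw [hxt, entry_matrixList]
    split_ifs at h_boundary ⊢ with hv
    · rw [decide_eq_true hv, cond_true]
      exact (isValid_singletonTable v).merge hx (card_boundary_le h_boundary)
    · rwa [decide_eq_false hv, cond_false]

/-- The instance of the algorithm for a graph with a tree decomposition. -/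
def inputOf (G : SimpleGraph (Fin n)) [DecidableRel G.Adj] (D : TreeDecomposition G (Fin N))
    [DecidableRel D.tree.Adj] : Input where
  graph := adjList G
  tree := adjList D.tree
  bags := matrixList fun t v => decide (v ∈ D.bag t)

theorem tabulates_partialBagTables (D : TreeDecomposition G (Fin N)) [DecidableRel D.tree.Adj]
    {k : ℕ} (hk : k ≤ n) : Tabulates G (D.width + 1) Finset.univ (partialBag D k)
      (partialBagTables (inputOf G D) k) := by
  induction k with
  | zero =>
    have h_empty (t : Fin N) : partialBag D 0 t = ∅ := by simp [partialBag]
    refine ⟨?_, ?_, fun t _ => ?_⟩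
    · simpa [partialBagTables, Function.comp_def] using List.nodup_range
    · refine List.forall_mem_map.2 fun t ht => ?_
      have ht : t < N := by simpa [inputOf, length_adjList] using ht
      exact ⟨⟨t, ht⟩, Finset.mem_univ _, rfl, h_empty _ ▸ isValid_empty t⟩
    · refine ⟨_, List.mem_map.2 ⟨t, ?_, rfl⟩, rfl⟩
      simp [inputOf, length_adjList]
  | succ k ih =>
    rw [partialBagTables, List.range_succ, List.foldl_append, ← partialBagTables]
    exact (ih (Nat.le_of_succ_le hk)).introduce (v := ⟨k, hk⟩)

section Contraction

variable {grp : Fin N → Fin N}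

/-- The list consists of the tables of the groups of a contraction of the tree. -/
def IsContraction (D : TreeDecomposition G (Fin N)) (l : List Table) : Prop :=
  ∃ grp, IsGrouping D.tree grp ∧
    Tabulates G (D.width + 1) {t | grp t = t} (groupSet D grp) l

theorem Tabulates.contract (hg : IsGrouping D.tree grp)
    (h : Tabulates G (D.width + 1) {t | grp t = t} (groupSet D grp) l) {x y : Table} {t s : Fin N}
    (hx : x ∈ l) (hxt : x.node = t) (hys : y.node = s) (hs : grp s = s) (hts : D.tree.Adj t s)
    (h_leaf : ∀ r, D.tree.Adj t r → grp r = r → r = s) :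
    IsContraction D (contract (adjList G) l x y) := by
  have hg' := hg.contract hts hs h_leaf
  obtain ⟨ht, hx⟩ := h.isValid hx hxt
  refine ⟨_, hg', ?_⟩
  have h_representatives : ({r | (if grp r = t then s else grp r) = r} : Finset (Fin N)) =
      ({r | grp r = r} : Finset (Fin N)).erase t := by
    have := hts.ne
    ext r
    simp only [Finset.mem_filter, Finset.mem_univ, true_and, Finset.mem_erase] at ht ⊢
    grind
  rw [h_representatives, MinStableCut.contract, hxt, hys]
  refine (h.erase t).map (fun z => ?_) fun r hr z hzr hz => ?_
  · cases z.node.beq s <;> rfl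
  · have h_boundary := hg'.boundary_groupSet_subset r
    rw [groupSet_contract hts.ne (Finset.ne_of_mem_erase hr)] at h_boundary ⊢
    rw [hzr]
    split_ifs at h_boundary ⊢ with hrs
    · rw [hrs, Nat.beq_refl, cond_true, ← hrs]
      exact hx.merge hz (card_boundary_le h_boundary)
    · have h_ne : (r : ℕ).beq s = false := by
        rwa [← Bool.not_eq_true, Nat.beq_eq, Fin.val_inj]
      rwa [h_ne, cond_false]

theorem length_contract_lt {M : List (List Bool)} {x y : Table} (hx : x ∈ l) :
    (contract M l x y).length < l.length := by
  rw [contract, List.length_map]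
  exact List.length_filter_lt_length_iff_exists.2 ⟨x, hx, by simp⟩

theorem mem_leafPairs {T : List (List Bool)} {x y : Table} : (x, y) ∈ leafPairs T l ↔
    x ∈ l ∧ y ∈ l ∧ entry T x.node y.node = true ∧
      ∀ z ∈ l, entry T x.node z.node = true → z.node = y.node := by
  simp only [leafPairs, List.mem_flatMap, List.mem_map, List.mem_filter, Bool.and_eq_true,
    List.all_eq_true, Bool.or_eq_true, Bool.not_eq_true', Nat.beq_eq, Prod.mk.injEq,
    ← Bool.not_eq_true, ← imp_iff_not_or]
  grind

theorem IsContraction.exists_isValid_univ (h : IsContraction D l) (hl : l.length ≤ 1) :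
    ∃ x, l = [x] ∧ x.IsValid G (D.width + 1) Finset.univ := by
  obtain ⟨grp, hg, hl'⟩ := h
  have h_grp (r s : Fin N) : grp r = grp s :=
    Finset.card_le_one.1 (hl'.length_eq ▸ hl) _ (by simp [hg.idem]) _ (by simp [hg.idem])
  obtain ⟨r⟩ := D.isTree.connected.nonempty
  obtain ⟨x, hx, hxr⟩ := hl'.exists_table (grp r) (by simp [hg.idem])
  have h_univ : groupSet D grp (grp r) = Finset.univ := Finset.eq_univ_iff_forall.2 fun v =>
    let ⟨s, hs⟩ := D.exists_mem_bag v
    mem_groupSet.2 ⟨s, h_grp s r, hs⟩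
  refine ⟨x, ?_, h_univ ▸ (hl'.isValid hx hxr).2⟩
  obtain ⟨y, rfl⟩ := List.length_eq_one_iff.1 (hl.antisymm (List.length_pos_of_mem hx))
  rw [List.mem_singleton.1 hx]

variable [DecidableRel D.tree.Adj]

theorem leafPairs_ne_nil (hg : IsGrouping D.tree grp)
    (h : Tabulates G (D.width + 1) {t | grp t = t} (groupSet D grp) l) (hl : 1 < l.length) :
    leafPairs (adjList D.tree) l ≠ [] := by
  obtain ⟨a, ha, b, hb, hab⟩ := Finset.one_lt_card.1 (h.length_eq ▸ hl)
  rw [Finset.mem_filter_univ] at ha hb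
  obtain ⟨t, s, ht, hs, hts, h_leaf⟩ :=
    hg.exists_leaf D.isTree (a := a) (b := b) (by rwa [ha, hb])
  obtain ⟨x, hx, hxt⟩ := h.exists_table t (Finset.mem_filter_univ _ |>.2 ht)
  obtain ⟨y, hy, hys⟩ := h.exists_table s (Finset.mem_filter_univ _ |>.2 hs)
  refine List.ne_nil_of_mem (mem_leafPairs.2 ⟨hx, hy, ?_, fun z hz hxz => ?_⟩)
  · rw [hxt, hys, entry_adjList, decide_eq_true hts]
  · obtain ⟨r, hr, hzr, -⟩ := h.exists_isValid z hz
    rw [hxt, hzr, entry_adjList, decide_eq_true_eq] at hxz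
    rw [hzr, hys, h_leaf r hxz (Finset.mem_filter.1 hr).2]

theorem IsContraction.contractLeaf (h : IsContraction D l) :
    IsContraction D (contractLeaf (adjList G) (adjList D.tree) l) ∧
      (contractLeaf (adjList G) (adjList D.tree) l).length ≤ max 1 (l.length - 1) := by
  obtain ⟨grp, hg, hl⟩ := h
  rw [MinStableCut.contractLeaf]
  rcases h_pairs : leafPairs (adjList D.tree) l with _ | ⟨⟨x, y⟩, L⟩
  · have h_length : l.length ≤ 1 := not_lt.1 fun h_lt => leafPairs_ne_nil hg hl h_lt h_pairs
    exact ⟨⟨grp, hg, hl⟩, h_length.trans (le_max_left _ _)⟩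
  · obtain ⟨hx, hy, hxy, h_leaf⟩ := mem_leafPairs.1 (h_pairs ▸ List.mem_cons_self)
    obtain ⟨t, ht, hxt, -⟩ := hl.exists_isValid x hx
    obtain ⟨s, hs, hys, -⟩ := hl.exists_isValid y hy
    rw [hxt, hys, entry_adjList, decide_eq_true_eq] at hxy
    refine ⟨hl.contract hg hx hxt hys (Finset.mem_filter.1 hs).2 hxy fun r htr hr => ?_,
      (Nat.le_sub_one_of_lt (length_contract_lt hx)).trans (le_max_right _ _)⟩
    obtain ⟨z, hz, hzr⟩ := hl.exists_table r (Finset.mem_filter_univ _ |>.2 hr)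
    have h_eq := h_leaf z hz (by rw [hxt, hzr, entry_adjList, decide_eq_true htr])
    rwa [hzr, hys, Fin.val_inj] at h_eq

theorem isContraction_partialBagTables (D : TreeDecomposition G (Fin N))
    [DecidableRel D.tree.Adj] : IsContraction D (partialBagTables (inputOf G D) n) := by
  refine ⟨id, isGrouping_id _, ?_⟩
  have h_set : groupSet D id = partialBag D n := by
    funext t
    ext v
    simp [mem_groupSet, partialBag]
  simpa [h_set] using tabulates_partialBagTables D le_rfl

theorem isContraction_contractedTables (D : TreeDecomposition G (Fin N))
    [DecidableRel D.tree.Adj] (k : ℕ) : IsContraction D (contractedTables (inputOf G D) k) ∧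
      (contractedTables (inputOf G D) k).length ≤ max 1 (N - k) := by
  induction k with
  | zero =>
    have h_zero : contractedTables (inputOf G D) 0 = partialBagTables (inputOf G D) n := by
      simp [contractedTables, inputOf, length_adjList]
    rw [h_zero]
    refine ⟨isContraction_partialBagTables D, ?_⟩
    rw [(tabulates_partialBagTables D le_rfl).length_eq]
    simp
  | succ k ih =>
    rw [contractedTables, List.range_succ, List.foldl_append, ← contractedTables]
    refine ⟨ih.1.contractLeaf.1, ih.1.contractLeaf.2.trans ?_⟩
    omega

end Contraction

theorem solve_inputOf (D : TreeDecomposition G (Fin N)) [DecidableRel D.tree.Adj] :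
    (solve (inputOf G D)).length = n ∧
      IsUnweightedOptimal G (cutOf n (solve (inputOf G D))) := by
  rw [solve, show (inputOf G D).graph = adjList G from rfl]
  cases hG : isMatching (adjList G) with
  | true => exact ⟨length_matchingCut,
      isUnweightedOptimal_matchingCut (isMatching_adjList.1 hG)⟩
  | false =>
    obtain ⟨h_contraction, h_length⟩ := isContraction_contractedTables D N
    obtain ⟨x, hx, h_valid⟩ := h_contraction.exists_isValid_univ (by simpa using h_length)
    rw [cond_false, show (inputOf G D).tree.length = N from length_adjList _, hx,
      List.flatMap_singleton]
    have h_mem : (bestCuts (adjList G) x).headD [] ∈ bestCuts (adjList G) x := by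
      rw [List.headD_eq_head?_getD, List.head?_eq_some_head h_valid.bestCuts_ne_nil]
      exact List.head_mem _
    obtain ⟨h_cut, h_optimal⟩ := h_valid.mem_bestCuts_iff.1 h_mem
    exact ⟨h_valid.length_cut _ h_cut, h_optimal⟩

end Correctness

/-! ### The running time in terms of the graph and the decomposition -/

section InstanceSize

variable {n N : ℕ} {G : SimpleGraph (Fin n)}

theorem TreeDecomposition.one_le_card_nodes (D : TreeDecomposition G (Fin N)) : 1 ≤ N :=
  let ⟨t⟩ := D.isTree.connected.nonempty
  t.pos

variable [DecidableRel G.Adj]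

theorem encode_ofFn {α : Type} [Encoded α] {m : ℕ} (f : Fin m → α) :
    encode (List.ofFn f) = Data.ofList (List.ofFn fun i => encode (f i)) :=
  congrArg Data.ofList List.map_ofFn

theorem encode_inputOf (D : TreeDecomposition G (Fin N)) [DecidableRel D.tree.Adj] :
    encode (inputOf G D) = encodeInstance G D := by
  have h_matrix {k m : ℕ} (f : Fin k → Fin m → Bool) :
      encode (matrixList f) = Data.ofMatrix f := by
    simp only [matrixList, encode_ofFn]
    rfl
  rw [encodeInstance, ← h_matrix, ← h_matrix, ← h_matrix]
  rfl

theorem size_list_bool (l : List Bool) : size l = 2 * l.length + 1 := by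
  induction l with
  | nil => rfl
  | cons b l ih => rw [size_cons, ih, List.length_cons, show size b = 1 from rfl]; ring

theorem size_le_of_length_eq {l : List (List Bool)} (h : ∀ p ∈ l, p.length = n) :
    size l ≤ l.length * (2 * n + 2) + 1 :=
  size_le_of_forall_mem fun p hp => by rw [size_list_bool, h p hp]

theorem size_matrixList {m : ℕ} (f : Fin m → Fin n → Bool) :
    size (matrixList f) ≤ m * (2 * n + 2) + 1 := by
  refine (size_le_of_length_eq (n := n) fun p hp => ?_).trans_eq (by rw [length_matrixList])
  obtain ⟨i, rfl⟩ := List.mem_ofFn.1 hp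
  exact List.length_ofFn

theorem Tabulates.size_le {b : ℕ} {R : Finset (Fin N)} {S : Fin N → Finset (Fin n)}
    {l : List Table} (h : Tabulates G b R S l) :
    size l ≤ N * (N + 2 * n + tableBound G b * (2 * n + 2) + 6) + 1 := by
  refine (size_le_of_forall_mem (k := N + 2 * n + tableBound G b * (2 * n + 2) + 5)
    fun x hx => ?_).trans ?_
  · obtain ⟨t, -, hxt, h_valid⟩ := h.exists_isValid x hx
    have h_cuts : size x.cuts ≤ tableBound G b * (2 * n + 2) + 1 :=
      (size_le_of_length_eq h_valid.length_cut).trans <|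
        Nat.add_le_add_right (Nat.mul_le_mul_right _ h_valid.length_cuts_le) 1
    rw [size_table, size_prod, size_prod, size_nat, size_list_bool, h_valid.length_vertices, hxt]
    dsimp only
    omega
  · have h_length : l.length ≤ N := h.length_eq ▸ R.card_le_univ.trans_eq (Fintype.card_fin N)
    gcongr

theorem size_inputOf_le (D : TreeDecomposition G (Fin N)) [DecidableRel D.tree.Adj] :
    size (inputOf G D) ≤ 17 * (n + N) ^ 2 := by
  have h_graph := size_matrixList fun u v => decide (G.Adj u v)
  have h_tree := size_matrixList fun s t => decide (D.tree.Adj s t)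
  have h_bags := size_matrixList fun t v => decide (v ∈ D.bag t)
  have hN := D.one_le_card_nodes
  rw [size_input, size_prod, size_prod]
  simp only [inputOf, adjList]
  nlinarith

/-- One factor `Δ ^ 3` is absorbed into the power of `n + 1`, which leaves an exponent of `Δ` that
is proportional to `w` instead of `w + 1`. -/
theorem tableBound_le (hG : 2 ≤ G.maxDegree) (w : ℕ) :
    tableBound G (w + 1) ≤ G.maxDegree ^ (3 * w) * (2 * (n + 1) ^ 5) := by
  have h_le : G.maxDegree ≤ n := G.maxDegree_le_of_forall_degree_le _ fun u =>
    (G.degree_lt_card_verts u).le.trans_eq (Fintype.card_fin n)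
  have h_cube : 2 * (G.maxDegree + 1) ≤ G.maxDegree ^ 3 := by
    nlinarith [mul_self_nonneg G.maxDegree]
  calc tableBound G (w + 1) ≤ (G.maxDegree ^ 3) ^ (w + 1) * (2 * (n * n + 1)) := by
        unfold tableBound; gcongr
    _ = G.maxDegree ^ (3 * w) * (2 * (G.maxDegree ^ 3 * (n * n + 1))) := by ring
    _ ≤ G.maxDegree ^ (3 * w) * (2 * ((n + 1) ^ 3 * (n + 1) ^ 2)) := by
        gcongr
        · exact h_le.trans n.le_succ
        · nlinarith
    _ = G.maxDegree ^ (3 * w) * (2 * (n + 1) ^ 5) := by ring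

theorem affordable_inputOf (D : TreeDecomposition G (Fin N)) [DecidableRel D.tree.Adj]
    (hG : isMatching (adjList G) = false) :
    Affordable (inputOf G D) (13 * (G.maxDegree ^ (3 * D.width) * (n + N) ^ 7)) := by
  obtain ⟨v, hv⟩ : ∃ v, 1 < G.degree v := by
    simpa only [← Bool.not_eq_true, isMatching_adjList, not_forall, not_le] using hG
  have h_degree : 2 ≤ G.maxDegree := hv.trans_le (G.degree_le_maxDegree v)
  have hN := D.one_le_card_nodes
  have h_le {R : Finset (Fin N)} {S : Fin N → Finset (Fin n)} {l : List Table}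
      (h : Tabulates G (D.width + 1) R S l) :
      size l ≤ 13 * (G.maxDegree ^ (3 * D.width) * (n + N) ^ 7) := by
    obtain ⟨E, hE⟩ : ∃ E, E = G.maxDegree ^ (3 * D.width) := ⟨_, rfl⟩
    have hE_pos : 1 ≤ E := hE ▸ Nat.one_le_pow _ _ (by omega)
    have h_pow {i : ℕ} (hi : i ≤ 7) : (n + N) ^ i ≤ E * (n + N) ^ 7 :=
      (Nat.pow_le_pow_right (by omega) hi).trans (Nat.le_mul_of_pos_left _ hE_pos)
    have h_table : tableBound G (D.width + 1) ≤ E * (2 * (n + N) ^ 5) :=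
      (hE ▸ tableBound_le h_degree D.width).trans (by gcongr)
    rw [← hE]
    calc size l ≤ (n + N) * (2 * (n + N) + E * (2 * (n + N) ^ 5) * (2 * (n + N)) + 6) + 1 :=
          h.size_le.trans (by gcongr <;> omega)
      _ = 2 * (n + N) ^ 2 + 4 * (E * (n + N) ^ 7) + 6 * (n + N) ^ 1 + (n + N) ^ 0 := by ring
      _ ≤ 13 * (E * (n + N) ^ 7) := by
          have := h_pow (i := 2) (by norm_num)
          have := h_pow (i := 1) (by norm_num)
          have := h_pow (i := 0) (by norm_num)
          omega
  refine ⟨fun k hk => ?_, fun k _ => ?_⟩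
  · exact h_le (tabulates_partialBagTables D (hk.trans_eq (length_adjList G)))
  · obtain ⟨⟨grp, -, h⟩, -⟩ := isContraction_contractedTables D k
    exact h_le h

theorem budget_pow_le (D : TreeDecomposition G (Fin N)) [DecidableRel D.tree.Adj] (c : ℕ) :
    (size (inputOf G D) + 13 * (G.maxDegree ^ (3 * D.width) * (n + N) ^ 7) + 2) ^ c ≤
      (32 ^ c + 7 * c) * max G.maxDegree 1 ^ ((32 ^ c + 7 * c) * D.width) *
        (n + N) ^ (32 ^ c + 7 * c) := by
  have hN := D.one_le_card_nodes
  have h_le : G.maxDegree ^ (3 * D.width) * (n + N) ^ 7 ≤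
      max G.maxDegree 1 ^ (3 * D.width) * (n + N) ^ 7 := by gcongr; exact le_max_left _ _
  have h_one : 1 ≤ max G.maxDegree 1 ^ (3 * D.width) := Nat.one_le_pow _ _ (by positivity)
  have h_square : (n + N) ^ 2 ≤ max G.maxDegree 1 ^ (3 * D.width) * (n + N) ^ 7 :=
    (Nat.pow_le_pow_right (by omega) (by norm_num)).trans (Nat.le_mul_of_pos_left _ h_one)
  have h_pos : 1 ≤ (n + N) ^ 2 := Nat.one_le_pow _ _ (by omega)
  calc _ ≤ (32 * (max G.maxDegree 1 ^ (3 * D.width) * (n + N) ^ 7)) ^ c := by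
        gcongr
        linarith [size_inputOf_le D]
    _ = 32 ^ c * max G.maxDegree 1 ^ (3 * c * D.width) * (n + N) ^ (7 * c) := by
        rw [mul_pow, mul_pow, ← pow_mul, ← pow_mul, mul_right_comm 3, mul_assoc (32 ^ c)]
    _ ≤ _ := by
        gcongr
        · exact Nat.le_add_right _ _
        · exact le_max_right _ _
        · exact le_add_left (by omega)
        · omega
        · exact Nat.le_add_left _ _

end InstanceSize

end MinStableCut

/-- A single program solves Unweighted Min Stable Cut on every graph with vertices `0, …, n - 1`
that is given with a tree decomposition with nodes `0, …, N - 1`, in time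
`Δ ^ O(tw) * (n + N) ^ O(1)`; an edgeless graph counts as one with `Δ = 1`. -/
theorem corollary5p1 :
    ∃ (p : MinStableCut.Program) (c : ℕ),
      ∀ (n N : ℕ) (G : SimpleGraph (Fin n)) [DecidableRel G.Adj]
        (D : MinStableCut.TreeDecomposition G (Fin N)) [DecidableRel D.tree.Adj],
        ∃ (side : Fin n → Bool) (t : ℕ),
          p.Outputs (MinStableCut.encodeInstance G D) (MinStableCut.Data.ofVector side) t ∧
          MinStableCut.IsUnweightedOptimal G side ∧
          t ≤ c * (max G.maxDegree 1) ^ (c * D.width) * (n + N) ^ c := by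
  obtain ⟨p, c, hp⟩ := MinStableCut.exists_program_solve
  refine ⟨p, 32 ^ c + 7 * c, fun n N G _ D _ => ?_⟩
  obtain ⟨h_length, h_optimal⟩ := MinStableCut.solve_inputOf D
  obtain ⟨t, ht, h_outputs⟩ := hp (MinStableCut.inputOf G D) _ (MinStableCut.affordable_inputOf D)
  refine ⟨_, t, ?_, h_optimal, ht.trans (MinStableCut.budget_pow_le D c)⟩
  rwa [MinStableCut.encode_inputOf, ← MinStableCut.ofFn_cutOf h_length,
    MinStableCut.encode_ofFn] at h_outputs
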